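/- Let $a\neq 0$ be a real constant and let $\mathcal M$ be a real function that is $C^3$ on a neighbourhood of $r=0$ (negative values of $r$ are allowed). Consider, in coordinates $(t,r,\theta,\phi)$, the Kerr-like metric $$ds^2=-\frac{\Delta_r}{\Sigma}(dt-a\sin^2\theta\,d\phi)^2+\frac{\Sigma}{\Delta_r}dr^2+\Sigma\,d\theta^2+\frac{\sin^2\theta}{\Sigma}\bigl(a\,dt-(r^2+a^2)d\phi\bigr)^2,$$ where $\Sigma=r^2+a^2\cos^2\theta$ and $\Delta_r=r^2-2\mathcal M(r)\,r+a^2$. A second-order curvature invariant is a scalar polynomial in the Riemann tensor, i.e. a real linear combination of complete contractions of products of Riemann tensors, metrics and volume forms $\epsilon$. A path approaching the ring is a continuous path in the region $0<\theta<\pi$, $\Sigma\neq0$, $\Delta_r\neq0$ along which $(r,\theta)\to(0,\pi/2)$. A scalar is finite at the ring if along every path approaching the ring it is bounded near the end of the path; it diverges along a path if its absolute value tends to infinity there. Let $\mathcal R$ be the curvature scalar and $$I_6=\tfrac1{12}S_\alpha{}^\beta S_\beta{}^\alpha,\qquad I=\tfrac1{24}\bar C_{\alpha\beta\gamma\delta}\bar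 C^{\alpha\beta\gamma\delta},\qquad K=\tfrac14\bar C_{\alpha\gamma\delta\beta}S^{\gamma\delta}S^{\alpha\beta},$$ where $S_{\alpha\beta}=R_{\alpha\beta}-\tfrac14\mathcal R g_{\alpha\beta}$, $C$ is the Weyl tensor, $*C_{\alpha\beta\gamma\delta}=\tfrac12\epsilon_{\alpha\beta\mu\nu}C^{\mu\nu}{}_{\gamma\delta}$ and $\bar C=\tfrac12(C+i\,{*C})$. Then the following are equivalent: 1. all second-order curvature invariants are finite at the ring $(r=0,\theta=\pi/2)$; 2. no second-order curvature invariant diverges along any path approaching the ring; 3. $\mathcal R$, $I_6$, $I$ and $K$ are finite at the ring; 4. $\mathcal M(0)=\mathcal M'(0)=\mathcal M''(0)=0$. -/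

import Mathlib

open Filter Topology

noncomputable section

namespace KerrLike

/-! ### Pseudo-Riemannian geometry of a metric given in a coordinate chart of `ℝ⁴` -/

/-- Coordinates of a point; for the Kerr-like metric `x = (t, r, θ, φ)`. -/
abbrev Coord : Type := Fin 4 → ℝ

/-- A field of covariant 2-tensors, by components. -/
abbrev MetricField : Type := Coord → Matrix (Fin 4) (Fin 4) ℝ

/-- The partial derivative `∂f/∂x^μ` at `x`. -/
def pderiv (μ : Fin 4) (f : Coord → ℝ) (x : Coord) : ℝ :=
  deriv (fun s : ℝ => f (Function.update x μ s)) (x μ)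

/-- The Christoffel symbols `Γ^c_{ab}` of the metric `g`. -/
def christoffel (g : MetricField) (c a b : Fin 4) (x : Coord) : ℝ :=
  (1 / 2) * ∑ d, (g x)⁻¹ c d *
    (pderiv a (fun y => g y d b) x + pderiv b (fun y => g y d a) x
      - pderiv d (fun y => g y a b) x)

/-- The Riemann tensor `R^a_{bcd}`. -/
def riemannUp (g : MetricField) (x : Coord) (a b c d : Fin 4) : ℝ :=
  pderiv c (christoffel g a d b) x - pderiv d (christoffel g a c b) x
    + ∑ e, (christoffel g a c e x * christoffel g e d b x
      - christoffel g a d e x * christoffel g e c b x)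

/-- The covariant Riemann tensor `R_{abcd}`. -/
def riemann (g : MetricField) (x : Coord) (a b c d : Fin 4) : ℝ :=
  ∑ e, g x a e * riemannUp g x e b c d

/-- The Ricci tensor `R_{bd} = R^a_{bad}`. -/
def ricci (g : MetricField) (x : Coord) (b d : Fin 4) : ℝ :=
  ∑ a, riemannUp g x a b a d

/-- The curvature scalar `ℛ`. -/
def scalarCurv (g : MetricField) (x : Coord) : ℝ :=
  ∑ a, ∑ b, (g x)⁻¹ a b * ricci g x a b

/-- The Weyl tensor `C_{abcd}` in dimension four. -/
def weyl (g : MetricField) (x : Coord) (a b c d : Fin 4) : ℝ :=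
  riemann g x a b c d
    - (1 / 2) * (g x a c * ricci g x b d - g x a d * ricci g x b c
      - g x b c * ricci g x a d + g x b d * ricci g x a c)
    + scalarCurv g x / 6 * (g x a c * g x b d - g x a d * g x b c)

/-- The alternating symbol `[abcd]`, with `[0123] = 1`. -/
def altSymbol (a b c d : Fin 4) : ℝ :=
  Matrix.det (Matrix.of fun i j : Fin 4 => if ![a, b, c, d] i = j then (1 : ℝ) else 0)

/-- The volume form `ε_{abcd}`. -/
def volForm (g : MetricField) (x : Coord) (a b c d : Fin 4) : ℝ :=
  √|(g x).det| * altSymbol a b c d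

/-- The dual Weyl tensor `*C_{abcd} = ε_{abmn} C^{mn}_{cd} / 2`. -/
def weylDual (g : MetricField) (x : Coord) (a b c d : Fin 4) : ℝ :=
  (1 / 2) * ∑ m, ∑ n, ∑ m', ∑ n',
    volForm g x a b m n * (g x)⁻¹ m m' * (g x)⁻¹ n n' * weyl g x m' n' c d

/-- The tensor `(C + i *C) / 2`. -/
def weylBar (g : MetricField) (x : Coord) (a b c d : Fin 4) : ℂ :=
  ((weyl g x a b c d : ℂ) + Complex.I * (weylDual g x a b c d : ℂ)) / 2

/-- The trace-free Ricci tensor `S_{ab}`. -/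
def tfRicci (g : MetricField) (x : Coord) (a b : Fin 4) : ℝ :=
  ricci g x a b - scalarCurv g x / 4 * g x a b

/-- The tensor `S^{ab}`. -/
def tfRicciUp (g : MetricField) (x : Coord) (a b : Fin 4) : ℝ :=
  ∑ c, ∑ d, (g x)⁻¹ a c * (g x)⁻¹ b d * tfRicci g x c d

/-- `I₆ = S_a^b S_b^a / 12`. -/
def invI6 (g : MetricField) (x : Coord) : ℝ :=
  (1 / 12) * ∑ a, ∑ b, tfRicci g x a b * tfRicciUp g x a b

/-- `I = C̄_{abcd} C̄^{abcd} / 24`, where `C̄ = (C + i *C) / 2`. -/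
def invI (g : MetricField) (x : Coord) : ℂ :=
  (1 / 24) * ∑ a, ∑ b, ∑ c, ∑ d, weylBar g x a b c d *
    ∑ a', ∑ b', ∑ c', ∑ d',
      (((g x)⁻¹ a a' * (g x)⁻¹ b b' * (g x)⁻¹ c c' * (g x)⁻¹ d d' : ℝ) : ℂ)
        * weylBar g x a' b' c' d'

/-- `K = C̄_{acdb} S^{cd} S^{ab} / 4`, where `C̄ = (C + i *C) / 2`. -/
def invK (g : MetricField) (x : Coord) : ℂ :=
  (1 / 4) * ∑ a, ∑ b, ∑ c, ∑ d,
    weylBar g x a c d b * ((tfRicciUp g x c d * tfRicciUp g x a b : ℝ) : ℂ)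

/-! ### Scalar invariants polynomial in the Riemann tensor -/

/-- A scheme for contracting completely a product of `n` covariant tensors of rank four, each of
which is either the Riemann tensor or the volume form: `isRiemann` says which factors are Riemann
tensors, and `pairing` groups the `4n` index slots into `2n` pairs. -/
structure ContractionScheme where
  n : ℕ
  isRiemann : Fin n → Bool
  pairing : Fin (2 * n) × Fin 2 ≃ Fin n × Fin 4

/-- The complete contraction that a scheme describes: each pair of slots is contracted with the
inverse metric. -/
def ContractionScheme.eval (s : ContractionScheme) (g : MetricField) (x : Coord) : ℝ :=
  ∑ i : Fin s.n × Fin 4 → Fin 4,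
    (∏ k, (if s.isRiemann k then riemann g x else volForm g x)
      (i (k, 0)) (i (k, 1)) (i (k, 2)) (i (k, 3)))
    * ∏ p, (g x)⁻¹ (i (s.pairing (p, 0))) (i (s.pairing (p, 1)))

/-- The second order curvature invariants of `g`: the scalars polynomial in the Riemann tensor,
that is the real linear combinations of complete contractions of products of Riemann tensors,
metrics and volume forms. -/
def curvatureInvariants (g : MetricField) : Submodule ℝ (Coord → ℝ) :=
  Submodule.span ℝ (Set.range fun s : ContractionScheme => s.eval g)

/-! ### The Kerr-like metric -/

/-- `Σ = r² + a² cos² θ`. -/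
def sigma (a r θ : ℝ) : ℝ := r ^ 2 + a ^ 2 * Real.cos θ ^ 2

/-- `Δ_r = r² - 2 M(r) r + a²`. -/
def delta (a : ℝ) (M : ℝ → ℝ) (r : ℝ) : ℝ := r ^ 2 - 2 * M r * r + a ^ 2

/-- The components of `dt - a sin² θ dφ`. -/
def formT (a θ : ℝ) : Fin 4 → ℝ := ![1, 0, 0, -(a * Real.sin θ ^ 2)]

/-- The components of `a dt - (r² + a²) dφ`. -/
def formPhi (a r : ℝ) : Fin 4 → ℝ := ![a, 0, 0, -(r ^ 2 + a ^ 2)]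

/-- The components of `dr`. -/
def formR : Fin 4 → ℝ := ![0, 1, 0, 0]

/-- The components of `dθ`. -/
def formTheta : Fin 4 → ℝ := ![0, 0, 1, 0]

/-- The Kerr-like metric in Boyer-Lindquist-like coordinates `x = (t, r, θ, φ)`. -/
def metric (a : ℝ) (M : ℝ → ℝ) : MetricField := fun x =>
  Matrix.of fun μ ν =>
    -(delta a M (x 1) / sigma a (x 1) (x 2)) * (formT a (x 2) μ * formT a (x 2) ν)
    + sigma a (x 1) (x 2) / delta a M (x 1) * (formR μ * formR ν)
    + sigma a (x 1) (x 2) * (formTheta μ * formTheta ν)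
    + Real.sin (x 2) ^ 2 / sigma a (x 1) (x 2) * (formPhi a (x 1) μ * formPhi a (x 1) ν)

/-- The points where the coordinates are regular: off the ring, the axis and the horizons. -/
def chartDomain (a : ℝ) (M : ℝ → ℝ) : Set Coord :=
  {x | 0 < x 2 ∧ x 2 < Real.pi ∧ sigma a (x 1) (x 2) ≠ 0 ∧ delta a M (x 1) ≠ 0}

/-- A path `γ : (0, 1] → spacetime` that approaches the ring `(r = 0, θ = π/2)` as its parameter
tends to `0`. -/
structure IsPathToRing (a : ℝ) (M : ℝ → ℝ) (γ : ℝ → Coord) : Prop where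
  continuousOn : ContinuousOn γ (Set.Ioc 0 1)
  mem_chart : ∀ s ∈ Set.Ioc (0 : ℝ) 1, γ s ∈ chartDomain a M
  tendsto_r : Tendsto (fun s => γ s 1) (𝓝[>] 0) (𝓝 0)
  tendsto_theta : Tendsto (fun s => γ s 2) (𝓝[>] 0) (𝓝 (Real.pi / 2))

/-- The scalar `f` stays finite (bounded) on approach to the ring along every path. -/
def FiniteAtRing {E : Type*} [Norm E] (a : ℝ) (M : ℝ → ℝ) (f : Coord → E) : Prop :=
  ∀ γ : ℝ → Coord, IsPathToRing a M γ → ∃ B : ℝ, ∀ᶠ s in 𝓝[>] (0 : ℝ), ‖f (γ s)‖ ≤ B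

/-- The scalar `f` diverges on approach to the ring along some path. -/
def DivergesAtRing {E : Type*} [Norm E] (a : ℝ) (M : ℝ → ℝ) (f : Coord → E) : Prop :=
  ∃ γ : ℝ → Coord, IsPathToRing a M γ ∧ Tendsto (fun s => ‖f (γ s)‖) (𝓝[>] 0) atTop

end KerrLike

end

/-!
In Carter's orthonormal frame the curvature of the metric has four independent components, which
are combinations of `m = r M`, `m'` and `m''` with coefficients in `r` and `c = a cos θ`, divided
by powers of `Σ = r² + c²`. Since `r²` and `c²` are at most `Σ`, these components are bounded near
the ring as soon as `M = O(r³)`, `M' = O(r²)` and `M'' = O(r)`; and every invariant is a polynomial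
in them and in the sign of the orientation of the frame.

Conversely, on the equatorial plane `R_{0123}` vanishes and the only nonzero components are of the
form `R_{ABAB}`, up to symmetry. Such a tensor has `R_{ABCD} R^{ABCD}` equal to the sum of the
squares of its components, and so do its trace-free Ricci tensor and its Weyl tensor; the dual Weyl
tensor enters with the opposite sign, because its components carry all four indices. Hence the
Kretschmann scalar, and likewise `ℛ`, `I₆` and `Re I` together, control `R_{2323} = 2 M / r³`, which
is unbounded as `r → 0` unless `M(0) = M'(0) = M''(0) = 0`.
-/

noncomputable section

namespace KerrLike

open Matrix

/-! ### Partial derivatives -/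

section PartialDerivatives

variable {f g : Coord → ℝ} {x : Coord} (μ ν : Fin 4)

lemma hasDerivAt_update_coord (x : Coord) :
    HasDerivAt (fun s : ℝ => Function.update x μ s) (Pi.single μ (1 : ℝ)) (x μ) := by
  simpa using hasDerivAt_update x μ (x μ)

lemma pderiv_eq_of_hasFDerivAt {f' : Coord →L[ℝ] ℝ} (hf : HasFDerivAt f f' x) :
    pderiv μ f x = f' (Pi.single μ 1) := by
  have h : HasFDerivAt f f' (Function.update x μ (x μ)) := by
    rwa [Function.update_eq_self]
  exact (h.comp_hasDerivAt (x μ) (hasDerivAt_update_coord μ x)).deriv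

lemma pderiv_congr (h : f =ᶠ[𝓝 x] g) : pderiv μ f x = pderiv μ g x := by
  have hc : Tendsto (fun s : ℝ => Function.update x μ s) (𝓝 (x μ)) (𝓝 x) := by
    simpa using (hasDerivAt_update_coord μ x).continuousAt.tendsto
  exact EventuallyEq.deriv_eq (hc.eventually h)

lemma pderiv_const (k : ℝ) : pderiv μ (fun _ => k) x = 0 :=
  deriv_const _ _

lemma pderiv_add (hf : DifferentiableAt ℝ f x) (hg : DifferentiableAt ℝ g x) :
    pderiv μ (fun y => f y + g y) x = pderiv μ f x + pderiv μ g x := by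
  rw [pderiv_eq_of_hasFDerivAt μ hf.hasFDerivAt, pderiv_eq_of_hasFDerivAt μ hg.hasFDerivAt,
    pderiv_eq_of_hasFDerivAt μ (hf.hasFDerivAt.fun_add hg.hasFDerivAt)]
  rfl

lemma pderiv_mul (hf : DifferentiableAt ℝ f x) (hg : DifferentiableAt ℝ g x) :
    pderiv μ (fun y => f y * g y) x = pderiv μ f x * g x + f x * pderiv μ g x := by
  rw [pderiv_eq_of_hasFDerivAt μ hf.hasFDerivAt, pderiv_eq_of_hasFDerivAt μ hg.hasFDerivAt,
    pderiv_eq_of_hasFDerivAt μ (hf.hasFDerivAt.fun_mul hg.hasFDerivAt)]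
  simp only [_root_.add_apply, _root_.smul_apply, smul_eq_mul]
  ring

lemma pderiv_sum {ι : Type*} (s : Finset ι) {f : ι → Coord → ℝ}
    (hf : ∀ i ∈ s, DifferentiableAt ℝ (f i) x) :
    pderiv μ (fun y => ∑ i ∈ s, f i y) x = ∑ i ∈ s, pderiv μ (f i) x := by
  rw [pderiv_eq_of_hasFDerivAt μ (HasFDerivAt.fun_sum fun i hi => (hf i hi).hasFDerivAt)]
  simp only [_root_.sum_apply]
  exact Finset.sum_congr rfl fun i hi => (pderiv_eq_of_hasFDerivAt μ (hf i hi).hasFDerivAt).symm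

lemma pderiv_eventuallyEq_fderiv (hf : ContDiffAt ℝ 1 f x) :
    pderiv μ f =ᶠ[𝓝 x] fun y => fderiv ℝ f y (Pi.single μ 1) := by
  filter_upwards [hf.eventually (by simp)] with y hy
  exact pderiv_eq_of_hasFDerivAt μ (hy.differentiableAt one_ne_zero).hasFDerivAt

lemma differentiableAt_fderiv (hf : ContDiffAt ℝ 2 f x) : DifferentiableAt ℝ (fderiv ℝ f) x :=
  (hf.fderiv_right (m := 1) (by norm_num)).differentiableAt one_ne_zero

lemma differentiableAt_pderiv (hf : ContDiffAt ℝ 2 f x) : DifferentiableAt ℝ (pderiv μ f) x :=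
  ((differentiableAt_fderiv hf).clm_apply (differentiableAt_const _)).congr_of_eventuallyEq
    (pderiv_eventuallyEq_fderiv μ (hf.of_le (by norm_num)))

lemma pderiv_pderiv_eq_fderiv_fderiv (hf : ContDiffAt ℝ 2 f x) :
    pderiv μ (pderiv ν f) x = fderiv ℝ (fderiv ℝ f) x (Pi.single μ 1) (Pi.single ν 1) := by
  rw [pderiv_congr μ (pderiv_eventuallyEq_fderiv ν (hf.of_le (by norm_num))),
    pderiv_eq_of_hasFDerivAt μ
      ((differentiableAt_fderiv hf).hasFDerivAt.clm_apply (hasFDerivAt_const _ x))]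
  simp

lemma pderiv_comm (hf : ContDiffAt ℝ 2 f x) :
    pderiv μ (pderiv ν f) x = pderiv ν (pderiv μ f) x := by
  rw [pderiv_pderiv_eq_fderiv_fderiv μ ν hf, pderiv_pderiv_eq_fderiv_fderiv ν μ hf]
  exact (hf.isSymmSndFDerivAt (by simp)) _ _

end PartialDerivatives

/-! ### Matrix-valued functions -/

section MatrixCalculus

variable {l m n : Type*} {x : Coord}

/-- Differentiability of a matrix-valued function, entry by entry, so that no norm on matrices has
to be chosen. -/
def EntryDifferentiableAt (X : Coord → Matrix m n ℝ) (x : Coord) : Prop :=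
  ∀ i j, DifferentiableAt ℝ (fun y => X y i j) x

/-- The entrywise partial derivative `∂X/∂x^μ` of a matrix-valued function. -/
def pderivMat (μ : Fin 4) (X : Coord → Matrix m n ℝ) (x : Coord) : Matrix m n ℝ :=
  of fun i j => pderiv μ (fun y => X y i j) x

namespace EntryDifferentiableAt

variable {X Y : Coord → Matrix m n ℝ}

lemma congr_of_eventuallyEq (hX : EntryDifferentiableAt X x) (h : Y =ᶠ[𝓝 x] X) :
    EntryDifferentiableAt Y x := fun i j =>
  (hX i j).congr_of_eventuallyEq (h.mono fun _ hy => congrFun (congrFun hy i) j)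

lemma add (hX : EntryDifferentiableAt X x) (hY : EntryDifferentiableAt Y x) :
    EntryDifferentiableAt (fun y => X y + Y y) x :=
  fun i j => (hX i j).add (hY i j)

lemma mul [Fintype n] {Y : Coord → Matrix n l ℝ} (hX : EntryDifferentiableAt X x)
    (hY : EntryDifferentiableAt Y x) : EntryDifferentiableAt (fun y => X y * Y y) x := fun i j => by
  simp only [mul_apply]
  exact DifferentiableAt.fun_sum fun k _ => (hX i k).mul (hY k j)

lemma transpose (hX : EntryDifferentiableAt X x) : EntryDifferentiableAt (fun y => (X y)ᵀ) x :=
  fun i j => hX j i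

end EntryDifferentiableAt

lemma entryDifferentiableAt_const (X : Matrix m n ℝ) : EntryDifferentiableAt (fun _ => X) x :=
  fun _ _ => differentiableAt_const _

variable {X Y : Coord → Matrix m n ℝ} (μ : Fin 4)

lemma pderivMat_congr (h : X =ᶠ[𝓝 x] Y) : pderivMat μ X x = pderivMat μ Y x := by
  ext i j
  exact pderiv_congr μ (h.mono fun y hy => congrFun (congrFun hy i) j)

lemma pderivMat_add (hX : EntryDifferentiableAt X x) (hY : EntryDifferentiableAt Y x) :
    pderivMat μ (fun y => X y + Y y) x = pderivMat μ X x + pderivMat μ Y x := by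
  ext i j
  exact pderiv_add μ (hX i j) (hY i j)

lemma pderivMat_mul [Fintype n] {Y : Coord → Matrix n l ℝ} (hX : EntryDifferentiableAt X x)
    (hY : EntryDifferentiableAt Y x) :
    pderivMat μ (fun y => X y * Y y) x = pderivMat μ X x * Y x + X x * pderivMat μ Y x := by
  ext i j
  simp only [pderivMat, of_apply, mul_apply, Matrix.add_apply]
  rw [pderiv_sum μ _ fun k _ => (hX i k).fun_mul (hY k j), ← Finset.sum_add_distrib]
  exact Finset.sum_congr rfl fun k _ => pderiv_mul μ (hX i k) (hY k j)

lemma pderivMat_transpose : pderivMat μ (fun y => (X y)ᵀ) x = (pderivMat μ X x)ᵀ :=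
  rfl

lemma pderivMat_const (X : Matrix m n ℝ) : pderivMat μ (fun _ => X) x = 0 := by
  ext i j
  exact pderiv_const μ (X i j)

end MatrixCalculus

/-! ### The Cartan structure equations in a moving frame -/

/-- The `4 × 4` real matrices. -/
abbrev Mat : Type := Matrix (Fin 4) (Fin 4) ℝ

/-- The Christoffel symbols as matrices `(Γ_μ)^c_b`. -/
def christoffelMat (g : MetricField) (μ : Fin 4) (x : Coord) : Mat :=
  of fun c b => christoffel g c μ b x

/-- The Riemann tensor as matrices `(R_{μν})^a_b`. -/
def riemannMat (g : MetricField) (x : Coord) (μ ν : Fin 4) : Mat :=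
  of fun a b => riemannUp g x a b μ ν

lemma riemannMat_eq (g : MetricField) (x : Coord) (μ ν : Fin 4) :
    riemannMat g x μ ν = pderivMat μ (christoffelMat g ν) x - pderivMat ν (christoffelMat g μ) x
      + (christoffelMat g μ x * christoffelMat g ν x
        - christoffelMat g ν x * christoffelMat g μ x) := by
  ext a b
  simp only [riemannMat, riemannUp, pderivMat, christoffelMat, of_apply, Matrix.add_apply,
    Matrix.sub_apply, mul_apply, Finset.sum_sub_distrib]

/-- The connection matrices `A_μ = e^C_μ γ_C` in the coordinate directions, for a connection with
components `γ_C` along a frame with coframe `E = (e^C_μ)`. -/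
def connMat (E : Coord → Mat) (γ : Fin 4 → Coord → Mat) (μ : Fin 4) (y : Coord) : Mat :=
  ∑ C, E y C μ • γ C y

/-- The curvature `(R_{CD})^A_B` of a torsion-free connection with frame components `γ_C`, whose
derivatives along the frame are `dγ C D = e_C (γ_D)`; the last sum is the bracket `[e_C, e_D]`. -/
def frameCurv (γ : Fin 4 → Mat) (dγ : Fin 4 → Fin 4 → Mat) (C D : Fin 4) : Mat :=
  dγ C D - dγ D C + (γ C * γ D - γ D * γ C) - ∑ e, (γ C e D - γ D e C) • γ e

/-- On the open set `U`, the metric `g` has the constant components `η` in the coframe `E` with dual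
frame `F`, and `γ` is its torsion-free metric connection, in components along that frame. -/
structure IsMovingFrame (U : Set Coord) (g : MetricField) (η : Mat) (E F : Coord → Mat)
    (γ : Fin 4 → Coord → Mat) : Prop where
  isOpen : IsOpen U
  eta_mul_eta : η * η = 1
  eta_symm : ηᵀ = η
  metric_eq : ∀ y ∈ U, g y = (E y)ᵀ * η * E y
  mul_dual : ∀ y ∈ U, E y * F y = 1
  contDiffAt : ∀ y ∈ U, ∀ i j, ContDiffAt ℝ 2 (fun z => E z i j) y
  differentiableAt_dual : ∀ y ∈ U, EntryDifferentiableAt F y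
  differentiableAt_conn : ∀ y ∈ U, ∀ C, EntryDifferentiableAt (γ C) y
  skew : ∀ y ∈ U, ∀ C, (γ C y)ᵀ * η + η * γ C y = 0
  torsion : ∀ y ∈ U, ∀ μ ν A, (pderivMat μ E y + connMat E γ μ y * E y) A ν =
    (pderivMat ν E y + connMat E γ ν y * E y) A μ

namespace IsMovingFrame

variable {U : Set Coord} {g : MetricField} {η : Mat} {E F : Coord → Mat} {γ : Fin 4 → Coord → Mat}
  {x : Coord}

lemma dual_mul (h : IsMovingFrame U g η E F γ) (hx : x ∈ U) : F x * E x = 1 :=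
  mul_eq_one_comm.mp (h.mul_dual x hx)

lemma entryDifferentiableAt (h : IsMovingFrame U g η E F γ) (hx : x ∈ U) :
    EntryDifferentiableAt E x :=
  fun i j => (h.contDiffAt x hx i j).differentiableAt two_ne_zero

lemma inv_metric (h : IsMovingFrame U g η E F γ) (hx : x ∈ U) : (g x)⁻¹ = F x * η * (F x)ᵀ := by
  have hEF : (F x)ᵀ * (E x)ᵀ = 1 := by
    rw [← transpose_mul, h.mul_dual x hx, transpose_one]
  refine inv_eq_left_inv ?_
  calc F x * η * (F x)ᵀ * g x = F x * η * ((F x)ᵀ * (E x)ᵀ) * η * E x := by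
        rw [h.metric_eq x hx]; noncomm_ring
    _ = F x * (η * η) * E x := by rw [hEF]; noncomm_ring
    _ = 1 := by rw [h.eta_mul_eta, mul_one, h.dual_mul hx]

lemma inv_metric_mul (h : IsMovingFrame U g η E F γ) (hx : x ∈ U) :
    (g x)⁻¹ * (E x)ᵀ * η = F x := by
  have hEF : (F x)ᵀ * (E x)ᵀ = 1 := by
    rw [← transpose_mul, h.mul_dual x hx, transpose_one]
  calc (g x)⁻¹ * (E x)ᵀ * η = F x * η * ((F x)ᵀ * (E x)ᵀ) * η := by
        rw [h.inv_metric hx]; noncomm_ring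
    _ = F x * (η * η) := by rw [hEF]; noncomm_ring
    _ = F x := by rw [h.eta_mul_eta, mul_one]

lemma connMat_skew (h : IsMovingFrame U g η E F γ) (hx : x ∈ U) (μ : Fin 4) :
    (connMat E γ μ x)ᵀ * η + η * connMat E γ μ x = 0 := by
  simp only [connMat, transpose_sum, transpose_smul, Matrix.sum_mul, Matrix.mul_sum,
    ← Finset.sum_add_distrib, Matrix.smul_mul, Matrix.mul_smul, ← smul_add, h.skew x hx, smul_zero,
    Finset.sum_const_zero]

lemma pderivMat_metric (h : IsMovingFrame U g η E F γ) (hx : x ∈ U) (μ : Fin 4) :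
    pderivMat μ g x = (pderivMat μ E x + connMat E γ μ x * E x)ᵀ * η * E x
      + (E x)ᵀ * η * (pderivMat μ E x + connMat E γ μ x * E x) := by
  have hE := h.entryDifferentiableAt hx
  have hg : g =ᶠ[𝓝 x] fun y => (E y)ᵀ * η * E y :=
    mem_of_superset (h.isOpen.mem_nhds hx) h.metric_eq
  have hskew : (E x)ᵀ * ((connMat E γ μ x)ᵀ * η + η * connMat E γ μ x) * E x = 0 := by
    rw [h.connMat_skew hx, Matrix.mul_zero, Matrix.zero_mul]
  rw [pderivMat_congr μ hg, pderivMat_mul μ (hE.transpose.mul (entryDifferentiableAt_const η)) hE,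
    pderivMat_mul μ hE.transpose (entryDifferentiableAt_const η), pderivMat_const,
    pderivMat_transpose]
  refine (sub_eq_zero.mp (Eq.trans ?_ hskew)).symm
  simp only [transpose_add, transpose_mul]
  noncomm_ring

/-- Koszul's formula: by the vanishing of the torsion, `Q a d b = Q b d a` in the proof below, so
that `∂_a g_{db} = Q a b d + Q a d b` can be solved for `Q`. -/
lemma christoffelMat_eq (h : IsMovingFrame U g η E F γ) (hx : x ∈ U) (μ : Fin 4) :
    christoffelMat g μ x =
      (g x)⁻¹ * ((E x)ᵀ * η * (pderivMat μ E x + connMat E γ μ x * E x)) := by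
  set N : Fin 4 → Mat := fun μ => pderivMat μ E x + connMat E γ μ x * E x
  set Q : Fin 4 → Mat := fun μ => (E x)ᵀ * η * N μ with hQ
  have hQ_symm : ∀ a b d, Q a d b = Q b d a := fun a b d => by
    simp only [hQ, mul_apply (N := N _)]
    exact Finset.sum_congr rfl fun A _ => congrArg _ (h.torsion x hx a b A)
  have hdg : ∀ a d b, pderiv a (fun y => g y d b) x = Q a b d + Q a d b := fun a d b => by
    have hQt : (N a)ᵀ * η * E x = (Q a)ᵀ := by
      simp only [hQ, transpose_mul, transpose_transpose, h.eta_symm, Matrix.mul_assoc]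
    have hga := congrFun (congrFun (h.pderivMat_metric hx a) d) b
    rwa [hQt] at hga
  ext c b
  change _ = ((g x)⁻¹ * Q μ) c b
  simp only [christoffelMat, christoffel, of_apply, mul_apply (M := (g x)⁻¹), Finset.mul_sum]
  refine Finset.sum_congr rfl fun d _ => ?_
  rw [hdg, hdg, hdg, hQ_symm d μ b, hQ_symm d b μ, hQ_symm b μ d]
  ring

lemma mul_christoffelMat (h : IsMovingFrame U g η E F γ) (hx : x ∈ U) (μ : Fin 4) :
    E x * christoffelMat g μ x = pderivMat μ E x + connMat E γ μ x * E x := by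
  rw [h.christoffelMat_eq hx, ← Matrix.mul_assoc (g x)⁻¹, ← Matrix.mul_assoc (g x)⁻¹,
    h.inv_metric_mul hx, ← Matrix.mul_assoc, h.mul_dual x hx, Matrix.one_mul]

lemma entryDifferentiableAt_connMat (h : IsMovingFrame U g η E F γ) (hx : x ∈ U) (μ : Fin 4) :
    EntryDifferentiableAt (connMat E γ μ) x := fun i j => by
  simp only [connMat, Matrix.sum_apply, Matrix.smul_apply, smul_eq_mul]
  exact DifferentiableAt.fun_sum fun C _ =>
    (h.entryDifferentiableAt hx C μ).mul (h.differentiableAt_conn x hx C i j)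

lemma entryDifferentiableAt_pderivMat (h : IsMovingFrame U g η E F γ) (hx : x ∈ U) (μ : Fin 4) :
    EntryDifferentiableAt (pderivMat μ E) x :=
  fun i j => differentiableAt_pderiv μ (h.contDiffAt x hx i j)

lemma entryDifferentiableAt_christoffelMat (h : IsMovingFrame U g η E F γ) (hx : x ∈ U)
    (μ : Fin 4) : EntryDifferentiableAt (christoffelMat g μ) x := by
  refine ((h.differentiableAt_dual x hx).mul ((h.entryDifferentiableAt_pderivMat hx μ).add
    ((h.entryDifferentiableAt_connMat hx μ).mul
      (h.entryDifferentiableAt hx)))).congr_of_eventuallyEq ?_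
  filter_upwards [h.isOpen.mem_nhds hx] with y hy
  rw [← h.mul_christoffelMat hy, ← Matrix.mul_assoc, h.dual_mul hy, Matrix.one_mul]

lemma mul_pderivMat_christoffelMat (h : IsMovingFrame U g η E F γ) (hx : x ∈ U) (μ ν : Fin 4) :
    E x * pderivMat μ (christoffelMat g ν) x = pderivMat μ (pderivMat ν E) x
      + pderivMat μ (connMat E γ ν) x * E x + connMat E γ ν x * pderivMat μ E x
      - pderivMat μ E x * christoffelMat g ν x := by
  have hE := h.entryDifferentiableAt hx
  have hA := h.entryDifferentiableAt_connMat hx ν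
  have hΓ : (fun y => E y * christoffelMat g ν y) =ᶠ[𝓝 x]
      fun y => pderivMat ν E y + connMat E γ ν y * E y :=
    mem_of_superset (h.isOpen.mem_nhds hx) fun y hy => h.mul_christoffelMat hy ν
  have hd := pderivMat_congr μ hΓ
  rw [pderivMat_mul μ hE (h.entryDifferentiableAt_christoffelMat hx ν),
    pderivMat_add μ (h.entryDifferentiableAt_pderivMat hx ν) (hA.mul hE),
    pderivMat_mul μ hA hE, ← add_assoc] at hd
  exact eq_sub_of_add_eq' hd

lemma mul_riemannMat (h : IsMovingFrame U g η E F γ) (hx : x ∈ U) (μ ν : Fin 4) :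
    E x * riemannMat g x μ ν = (pderivMat μ (connMat E γ ν) x - pderivMat ν (connMat E γ μ) x
      + (connMat E γ μ x * connMat E γ ν x - connMat E γ ν x * connMat E γ μ x)) * E x := by
  have hs : pderivMat μ (pderivMat ν E) x = pderivMat ν (pderivMat μ E) x := by
    ext i j
    exact pderiv_comm μ ν (h.contDiffAt x hx i j)
  calc E x * riemannMat g x μ ν
      = E x * pderivMat μ (christoffelMat g ν) x - E x * pderivMat ν (christoffelMat g μ) x
        + ((E x * christoffelMat g μ x) * christoffelMat g ν x
          - (E x * christoffelMat g ν x) * christoffelMat g μ x) := by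
        rw [riemannMat_eq]
        noncomm_ring
    _ = (pderivMat μ (connMat E γ ν) x - pderivMat ν (connMat E γ μ) x) * E x
        + connMat E γ ν x * pderivMat μ E x - connMat E γ μ x * pderivMat ν E x
        + (connMat E γ μ x * (E x * christoffelMat g ν x)
          - connMat E γ ν x * (E x * christoffelMat g μ x)) := by
        rw [h.mul_pderivMat_christoffelMat hx, h.mul_pderivMat_christoffelMat hx, hs]
        conv_lhs => rw [h.mul_christoffelMat hx μ, h.mul_christoffelMat hx ν]
        noncomm_ring
    _ = _ := by
        rw [h.mul_christoffelMat hx, h.mul_christoffelMat hx]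
        noncomm_ring

lemma pderivMat_connMat (h : IsMovingFrame U g η E F γ) (hx : x ∈ U)
    {dγ : Fin 4 → Fin 4 → Mat} (hdγ : ∀ μ D, pderivMat μ (γ D) x = ∑ C, E x C μ • dγ C D)
    (μ ν : Fin 4) :
    pderivMat μ (connMat E γ ν) x = ∑ D, pderivMat μ E x D ν • γ D x
      + ∑ C, ∑ D, (E x C μ * E x D ν) • dγ C D := by
  have hprod : pderivMat μ (connMat E γ ν) x =
      ∑ D, (pderivMat μ E x D ν • γ D x + E x D ν • pderivMat μ (γ D) x) := by
    ext i j
    simp only [pderivMat, of_apply, connMat, Matrix.sum_apply, Matrix.smul_apply,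
      smul_eq_mul, Matrix.add_apply]
    rw [pderiv_sum μ _ fun D _ => (h.entryDifferentiableAt hx D ν).fun_mul
      (h.differentiableAt_conn x hx D i j)]
    exact Finset.sum_congr rfl fun D _ =>
      pderiv_mul μ (h.entryDifferentiableAt hx D ν) (h.differentiableAt_conn x hx D i j)
  rw [hprod, Finset.sum_add_distrib, Finset.sum_comm (γ := Fin 4)]
  simp only [hdγ, Finset.smul_sum, smul_smul, mul_comm]

lemma sum_sum_mul_smul_comm (a b : Fin 4 → ℝ) (X : Fin 4 → Fin 4 → Mat) :
    ∑ C, ∑ D, (b C * a D) • X C D = ∑ C, ∑ D, (a C * b D) • X D C := by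
  rw [Finset.sum_comm]
  simp only [mul_comm]

lemma connMat_mul_connMat (E : Coord → Mat) (γ : Fin 4 → Coord → Mat) (μ ν : Fin 4) (x : Coord) :
    connMat E γ μ x * connMat E γ ν x = ∑ C, ∑ D, (E x C μ * E x D ν) • (γ C x * γ D x) := by
  simp_rw [connMat, Matrix.sum_mul, Matrix.mul_sum, Matrix.smul_mul, Matrix.mul_smul, smul_smul]

lemma connMat_mul_apply (E : Coord → Mat) (γ : Fin 4 → Coord → Mat) (μ ν e : Fin 4) (x : Coord) :
    (connMat E γ μ x * E x) e ν = ∑ C, ∑ D, (E x C μ * E x D ν) * γ C x e D := by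
  rw [connMat, Matrix.sum_mul, Matrix.sum_apply]
  simp only [Matrix.smul_apply, mul_apply, smul_eq_mul]
  exact Finset.sum_congr rfl fun _ _ => Finset.sum_congr rfl fun _ _ => by ring

lemma sum_pderivMat_sub_smul (h : IsMovingFrame U g η E F γ) (hx : x ∈ U) (μ ν : Fin 4) :
    ∑ e, (pderivMat μ E x e ν - pderivMat ν E x e μ) • γ e x =
      -∑ C, ∑ D, (E x C μ * E x D ν) • ∑ e, (γ C x e D - γ D x e C) • γ e x := by
  have hde : ∀ e, pderivMat μ E x e ν - pderivMat ν E x e μ =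
      -∑ C, ∑ D, (E x C μ * E x D ν) * (γ C x e D - γ D x e C) := fun e => by
    have htorsion := h.torsion x hx μ ν e
    have hswap : ∑ C, ∑ D, (E x C ν * E x D μ) * γ C x e D =
        ∑ C, ∑ D, (E x C μ * E x D ν) * γ D x e C := by
      rw [Finset.sum_comm]
      simp only [mul_comm]
    simp only [Matrix.add_apply, connMat_mul_apply, hswap] at htorsion
    simp only [mul_sub, Finset.sum_sub_distrib]
    linarith
  simp only [hde, neg_smul, Finset.sum_neg_distrib, Finset.smul_sum, Finset.sum_smul, smul_smul]
  rw [Finset.sum_comm]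
  exact congrArg _ (Finset.sum_congr rfl fun _ _ => Finset.sum_comm)

theorem mul_riemannMat_eq_frameCurv (h : IsMovingFrame U g η E F γ) (hx : x ∈ U)
    {dγ : Fin 4 → Fin 4 → Mat} (hdγ : ∀ μ D, pderivMat μ (γ D) x = ∑ C, E x C μ • dγ C D)
    (μ ν : Fin 4) :
    E x * riemannMat g x μ ν =
      (∑ C, ∑ D, (E x C μ * E x D ν) • frameCurv (fun C => γ C x) dγ C D) * E x := by
  have hbracket := h.sum_pderivMat_sub_smul hx μ ν
  simp only [sub_smul, Finset.sum_sub_distrib] at hbracket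
  rw [h.mul_riemannMat hx, h.pderivMat_connMat hx hdγ, h.pderivMat_connMat hx hdγ,
    connMat_mul_connMat, connMat_mul_connMat,
    sum_sum_mul_smul_comm (fun C => E x C μ) (fun D => E x D ν),
    sum_sum_mul_smul_comm (fun C => E x C μ) (fun D => E x D ν), add_sub_add_comm, hbracket]
  simp only [frameCurv, smul_sub, smul_add, sub_smul, Finset.sum_sub_distrib,
    Finset.sum_add_distrib]
  congr 1
  abel

end IsMovingFrame

/-! ### Connections and curvatures of Kerr type -/

/-- The Minkowski metric. -/
def minkowski : Mat := diagonal ![-1, 1, 1, 1]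

/-- The shape of the connection in the Kerr-like frame: the matrices `γ_C`, depending on six
coefficients. -/
def connForm (k : Fin 6 → ℝ) : Fin 4 → Mat :=
  ![!![0, k 0, -k 1, 0; k 0, 0, 0, k 5; -k 1, 0, 0, k 2; 0, -k 5, -k 2, 0],
    !![0, 0, 0, k 5; 0, 0, -k 1, 0; 0, k 1, 0, 0; k 5, 0, 0, 0],
    !![0, 0, 0, -k 2; 0, 0, -k 3, 0; 0, k 3, 0, 0; -k 2, 0, 0, 0],
    !![0, k 5, k 2, 0; k 5, 0, 0, -k 3; k 2, 0, 0, -k 4; 0, k 3, k 4, 0]]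

/-- The tensor of rank four, antisymmetric in its first and in its last two indices, whose
components on the bivectors `01, 02, 03, 12, 13, 23` are `Q`. -/
def bivForm (Q : Matrix (Fin 6) (Fin 6) ℝ) (A B C D : Fin 4) : ℝ :=
  let sign : Mat := !![0, 1, 1, 1; -1, 0, 1, 1; -1, -1, 0, 1; -1, -1, -1, 0]
  let index : Matrix (Fin 4) (Fin 4) (Fin 6) := !![0, 0, 1, 2; 0, 0, 3, 4; 1, 3, 0, 5; 2, 4, 5, 0]
  sign A B * sign C D * Q (index A B) (index C D)

/-- The curvature, on bivectors, of the connection `connForm k` whose coefficients have derivatives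
`k₁` and `k₂` along the second and third frame vectors and `0` along the others. -/
def connCurv (k k₁ k₂ : Fin 6 → ℝ) : Matrix (Fin 6) (Fin 6) ℝ :=
  let α := k 0; let β := k 1; let δ := k 2; let ρ := k 3; let κ := k 4; let τ := k 5
  !![k₁ 0 + α ^ 2 + β ^ 2 - 3 * τ ^ 2, k₂ 0 - α * β + β * ρ + δ * τ, 0, 0,
      -(k₁ 5 - β * δ + 2 * ρ * τ), -(k₂ 5 + 2 * α * δ - 2 * δ * ρ + κ * τ);
    -(k₁ 1 + 3 * δ * τ), -(k₂ 1 - α * ρ - β ^ 2 - δ ^ 2), 0, 0,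
      -(k₁ 2 + β * τ + δ * ρ + κ * τ), -(k₂ 2 - 2 * β * δ + ρ * τ);
    0, 0, α * ρ - β * κ + δ ^ 2 + τ ^ 2, k₁ 2 + k₂ 5 - β * τ + δ * ρ, 0, 0;
    0, 0, α * δ + β * τ - δ * ρ + κ * τ, k₂ 1 - k₁ 3 - β ^ 2 - ρ ^ 2, 0, 0;
    -(k₁ 5 - β * δ + 2 * ρ * τ), -(k₂ 5 + α * δ - β * τ - δ * ρ), 0, 0,
      -(k₁ 3 - β * κ + ρ ^ 2 + τ ^ 2), -(k₂ 3 - 3 * δ * τ);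
    -(k₁ 2 + α * δ + 2 * β * τ + 2 * κ * τ), -(k₂ 2 - 2 * β * δ + ρ * τ), 0, 0,
      -(k₁ 4 + β * ρ + δ * τ + κ * ρ), -(k₂ 4 - 3 * δ ^ 2 + κ ^ 2 + ρ ^ 2)]

/-- The shape of the Riemann tensor in the Kerr-like frame, as a form on bivectors. -/
def curvMatrix (f : Fin 4 → ℝ) : Matrix (Fin 6) (Fin 6) ℝ :=
  !![f 0, 0, 0, 0, 0, 2 * f 3;
    0, f 2, 0, 0, f 3, 0;
    0, 0, f 2, -f 3, 0, 0;
    0, 0, -f 3, -f 2, 0, 0;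
    0, f 3, 0, 0, -f 2, 0;
    2 * f 3, 0, 0, 0, 0, f 1]

lemma bivForm_swap (Q : Matrix (Fin 6) (Fin 6) ℝ) (A B C D : Fin 4) :
    bivForm Q A B D C = -bivForm Q A B C D := by
  fin_cases C <;> fin_cases D <;> simp [bivForm]

lemma frameCurv_swap (γ : Fin 4 → Mat) (dγ : Fin 4 → Fin 4 → Mat) (C D : Fin 4) :
    frameCurv γ dγ D C = -frameCurv γ dγ C D := by
  have hbracket : ∑ e, (γ D e C - γ C e D) • γ e = -∑ e, (γ C e D - γ D e C) • γ e := by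
    simp only [← Finset.sum_neg_distrib, ← neg_smul, neg_sub]
  rw [frameCurv, frameCurv, hbracket]
  abel

lemma connForm_skew (k : Fin 6 → ℝ) (C : Fin 4) :
    (connForm k C)ᵀ * minkowski + minkowski * connForm k C = 0 := by
  ext i j
  rw [minkowski, Matrix.add_apply, mul_diagonal, diagonal_mul, transpose_apply]
  fin_cases C <;> fin_cases i <;> fin_cases j <;> simp [connForm]

lemma minkowski_mul_frameCurv_of_lt (k k₁ k₂ : Fin 6 → ℝ) {C D : Fin 4} (hCD : C < D) :
    ∀ A B, (minkowski * frameCurv (connForm k) ![0, connForm k₁, connForm k₂, 0] C D) A B =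
      bivForm (connCurv k k₁ k₂) A B C D := by
  fin_cases C <;> fin_cases D <;> (first | exact absurd hCD (by decide) | skip) <;>
    simp [frameCurv, connForm, Fin.sum_univ_four, minkowski, Fin.forall_fin_succ, bivForm,
      connCurv] <;>
    ring_nf <;> trivial

lemma minkowski_mul_frameCurv (k k₁ k₂ : Fin 6 → ℝ) (A B C D : Fin 4) :
    (minkowski * frameCurv (connForm k) ![0, connForm k₁, connForm k₂, 0] C D) A B =
      bivForm (connCurv k k₁ k₂) A B C D := by
  rcases lt_trichotomy C D with hCD | rfl | hCD
  · exact minkowski_mul_frameCurv_of_lt k k₁ k₂ hCD A B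
  · simp [self_eq_neg.mp (bivForm_swap _ A B C C), frameCurv]
  · rw [frameCurv_swap, bivForm_swap, Matrix.mul_neg, Matrix.neg_apply,
      minkowski_mul_frameCurv_of_lt k k₁ k₂ hCD A B]

lemma hasDerivAt_connForm {k : ℝ → Fin 6 → ℝ} {k' : Fin 6 → ℝ} {t : ℝ}
    (hk : HasDerivAt k k' t) (C A B : Fin 4) :
    HasDerivAt (fun t => connForm (k t) C A B) (connForm k' C A B) t := by
  have hk := hasDerivAt_pi.mp hk
  fin_cases C <;> fin_cases A <;> fin_cases B <;>
    first | exact hk _ | exact (hk _).neg | exact hasDerivAt_const _ _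

lemma entryDifferentiableAt_connForm {k : Coord → Fin 6 → ℝ} {x : Coord}
    (hk : DifferentiableAt ℝ k x) (C : Fin 4) :
    EntryDifferentiableAt (fun y => connForm (k y) C) x := by
  have hk := differentiableAt_pi.mp hk
  intro A B
  fin_cases C <;> fin_cases A <;> fin_cases B <;>
    first | exact hk _ | exact (hk _).neg | exact differentiableAt_const _

/-! ### The Kerr-like frame -/

/-- The coefficients of the connection of the Kerr-like metric in its orthonormal frame, in terms of
`p = √Δ_r`, `q = √Σ`, `r`, `s = sin θ`, `c = cos θ` and `d = Δ_r' / 2`. -/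
def kerrConnCoeff (a p q r s c d : ℝ) : Fin 6 → ℝ :=
  ![d / (p * q) - p * r / q ^ 3, a ^ 2 * c * s / q ^ 3, a * p * c / q ^ 3, p * r / q ^ 3,
    c / (s * q) + a ^ 2 * c * s / q ^ 3, a * r * s / q ^ 3]

/-- The differential of `kerrConnCoeff` in terms of those of its arguments. -/
def kerrConnCoeffDiff (a p q r s c d p' q' r' s' c' d' : ℝ) : Fin 6 → ℝ :=
  ![(d' - d * p' / p - d * q' / q) / (p * q) - (p' * r + p * r' - 3 * p * r * q' / q) / q ^ 3,
    a ^ 2 * (c' * s + c * s' - 3 * c * s * q' / q) / q ^ 3,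
    a * (p' * c + p * c' - 3 * p * c * q' / q) / q ^ 3,
    (p' * r + p * r' - 3 * p * r * q' / q) / q ^ 3,
    (c' - c * s' / s - c * q' / q) / (s * q)
      + a ^ 2 * (c' * s + c * s' - 3 * c * s * q' / q) / q ^ 3,
    a * (r' * s + r * s' - 3 * r * s * q' / q) / q ^ 3]

/-- The orthonormal coframe of the Kerr-like metric, in terms of the same quantities. -/
def kerrCoframeOf (a p q r s : ℝ) : Mat :=
  !![p / q, 0, 0, -(a * s ^ 2 * p / q);
    0, q / p, 0, 0;
    0, 0, q, 0;
    a * s / q, 0, 0, -((r ^ 2 + a ^ 2) * s / q)]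

/-- The differential of `kerrCoframeOf` in terms of those of its arguments. -/
def kerrCoframeDiff (a p q r s p' q' r' s' : ℝ) : Mat :=
  !![(p' - p * q' / q) / q, 0, 0, -(a * (2 * s * s' * p + s ^ 2 * p' - s ^ 2 * p * q' / q) / q);
    0, (q' - q * p' / p) / p, 0, 0;
    0, 0, q', 0;
    a * (s' - s * q' / q) / q, 0, 0,
      -((2 * r * r' * s + (r ^ 2 + a ^ 2) * s' - (r ^ 2 + a ^ 2) * s * q' / q) / q)]

/-- The frame dual to `kerrCoframeOf`. -/
def kerrFrameOf (a p q r s : ℝ) : Mat :=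
  !![(r ^ 2 + a ^ 2) / (p * q), 0, 0, -(a * s / q);
    0, p / q, 0, 0;
    0, 0, 1 / q, 0;
    a / (p * q), 0, 0, -(1 / (q * s))]

section ChainRule

variable {p q r s c d : ℝ → ℝ} {p' q' r' s' c' d' t : ℝ}

lemma hasDerivAt_kerrConnCoeff (a : ℝ) (hp : HasDerivAt p p' t) (hq : HasDerivAt q q' t)
    (hr : HasDerivAt r r' t) (hs : HasDerivAt s s' t) (hc : HasDerivAt c c' t)
    (hd : HasDerivAt d d' t) (hp0 : p t ≠ 0) (hq0 : q t ≠ 0) (hs0 : s t ≠ 0) :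
    HasDerivAt (fun t => kerrConnCoeff a (p t) (q t) (r t) (s t) (c t) (d t))
      (kerrConnCoeffDiff a (p t) (q t) (r t) (s t) (c t) (d t) p' q' r' s' c' d') t := by
  have hq3 := hq.fun_pow 3
  have hq30 := pow_ne_zero 3 hq0
  have hpr := (hp.fun_mul hr).fun_div hq3 hq30
  have hcs := (((hc.const_mul (a ^ 2)).fun_mul hs)).fun_div hq3 hq30
  refine hasDerivAt_pi.mpr fun i => ?_
  fin_cases i
  · refine ((hd.fun_div (hp.fun_mul hq) (mul_ne_zero hp0 hq0)).fun_sub hpr).congr_deriv ?_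
    simp [kerrConnCoeffDiff]
    field_simp
    ring
  · refine hcs.congr_deriv ?_
    simp [kerrConnCoeffDiff]
    field_simp
  · refine (((hp.const_mul a).fun_mul hc).fun_div hq3 hq30).congr_deriv ?_
    simp [kerrConnCoeffDiff]
    field_simp
  · refine hpr.congr_deriv ?_
    simp [kerrConnCoeffDiff]
    field_simp
  · refine ((hc.fun_div (hs.fun_mul hq) (mul_ne_zero hs0 hq0)).fun_add hcs).congr_deriv ?_
    simp [kerrConnCoeffDiff]
    field_simp
    ring
  · refine (((hr.const_mul a).fun_mul hs).fun_div hq3 hq30).congr_deriv ?_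
    simp [kerrConnCoeffDiff]
    field_simp

lemma hasDerivAt_kerrCoframeOf (a : ℝ) (hp : HasDerivAt p p' t) (hq : HasDerivAt q q' t)
    (hr : HasDerivAt r r' t) (hs : HasDerivAt s s' t) (hp0 : p t ≠ 0) (hq0 : q t ≠ 0)
    (i j : Fin 4) :
    HasDerivAt (fun t => kerrCoframeOf a (p t) (q t) (r t) (s t) i j)
      (kerrCoframeDiff a (p t) (q t) (r t) (s t) p' q' r' s' i j) t := by
  have h₀₃ := ((((hs.fun_pow 2).const_mul a).fun_mul hp).fun_div hq hq0).fun_neg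
  have h₃₀ := (hs.const_mul a).fun_div hq hq0
  have h₃₃ := ((((hr.fun_pow 2).add_const (a ^ 2)).fun_mul hs).fun_div hq hq0).fun_neg
  fin_cases i <;> fin_cases j <;>
    (first
      | exact hasDerivAt_const _ _
      | exact hq
      | refine HasDerivAt.congr_deriv (hp.fun_div hq hq0) ?_
      | refine HasDerivAt.congr_deriv (hq.fun_div hp hp0) ?_
      | refine HasDerivAt.congr_deriv h₀₃ ?_
      | refine HasDerivAt.congr_deriv h₃₀ ?_
      | refine HasDerivAt.congr_deriv h₃₃ ?_) <;>
    simp [kerrCoframeDiff] <;> field_simp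

end ChainRule

/-- `√Δ_r`. -/
def sqrtDelta (a : ℝ) (M : ℝ → ℝ) (r : ℝ) : ℝ := √(delta a M r)

/-- `√Σ`. -/
def sqrtSigma (a r θ : ℝ) : ℝ := √(sigma a r θ)

/-- `Δ_r' / 2`. -/
def halfDerivDelta (M : ℝ → ℝ) (r : ℝ) : ℝ := r - M r - r * deriv M r

/-- The part of the chart where `Δ_r` is positive and `M` is smooth. -/
def frameDomain (a : ℝ) (M : ℝ → ℝ) : Set Coord :=
  {x | ContDiffAt ℝ 2 M (x 1) ∧ 0 < delta a M (x 1) ∧ 0 < x 2 ∧ x 2 < Real.pi ∧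
    0 < sigma a (x 1) (x 2)}

/-- The orthonormal coframe of the Kerr-like metric. -/
def kerrCoframe (a : ℝ) (M : ℝ → ℝ) (x : Coord) : Mat :=
  kerrCoframeOf a (sqrtDelta a M (x 1)) (sqrtSigma a (x 1) (x 2)) (x 1) (Real.sin (x 2))

/-- The orthonormal frame of the Kerr-like metric. -/
def kerrFrame (a : ℝ) (M : ℝ → ℝ) (x : Coord) : Mat :=
  kerrFrameOf a (sqrtDelta a M (x 1)) (sqrtSigma a (x 1) (x 2)) (x 1) (Real.sin (x 2))

/-- The connection of the Kerr-like metric in its orthonormal frame. -/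
def kerrConn (a : ℝ) (M : ℝ → ℝ) (C : Fin 4) (x : Coord) : Mat :=
  connForm (kerrConnCoeff a (sqrtDelta a M (x 1)) (sqrtSigma a (x 1) (x 2)) (x 1) (Real.sin (x 2))
    (Real.cos (x 2)) (halfDerivDelta M (x 1))) C

/-- The derivative of `kerrCoframe` along the vector `v`. -/
def kerrCoframeDeriv (a : ℝ) (M : ℝ → ℝ) (v x : Coord) : Mat :=
  let p := sqrtDelta a M (x 1); let q := sqrtSigma a (x 1) (x 2)
  let s := Real.sin (x 2); let c := Real.cos (x 2)
  kerrCoframeDiff a p q (x 1) s (halfDerivDelta M (x 1) * v 1 / p)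
    ((x 1 * v 1 - a ^ 2 * c * s * v 2) / q) (v 1) (c * v 2)

/-- The derivative of the coefficients of `kerrConn` along the vector `v`. -/
def kerrConnDeriv (a : ℝ) (M : ℝ → ℝ) (v x : Coord) : Fin 6 → ℝ :=
  let p := sqrtDelta a M (x 1); let q := sqrtSigma a (x 1) (x 2)
  let s := Real.sin (x 2); let c := Real.cos (x 2)
  kerrConnCoeffDiff a p q (x 1) s c (halfDerivDelta M (x 1)) (halfDerivDelta M (x 1) * v 1 / p)
    ((x 1 * v 1 - a ^ 2 * c * s * v 2) / q) (v 1) (c * v 2) (-s * v 2)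
    ((1 - 2 * deriv M (x 1) - x 1 * deriv (deriv M) (x 1)) * v 1)

section Derivatives

variable {a : ℝ} {M : ℝ → ℝ} {r θ : ℝ}

lemma sqrtDelta_pos (h : 0 < delta a M r) : 0 < sqrtDelta a M r := Real.sqrt_pos.mpr h

lemma sqrtSigma_pos (h : 0 < sigma a r θ) : 0 < sqrtSigma a r θ := Real.sqrt_pos.mpr h

lemma sqrtDelta_sq (h : 0 < delta a M r) : sqrtDelta a M r ^ 2 = delta a M r := Real.sq_sqrt h.le

lemma sqrtSigma_sq (h : 0 < sigma a r θ) : sqrtSigma a r θ ^ 2 = sigma a r θ := Real.sq_sqrt h.le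

lemma hasDerivAt_halfDerivDelta (hM : ContDiffAt ℝ 2 M r) :
    HasDerivAt (halfDerivDelta M) (1 - 2 * deriv M r - r * deriv (deriv M) r) r := by
  have hM₁ : HasDerivAt M (deriv M r) r := (hM.differentiableAt two_ne_zero).hasDerivAt
  have hM₂ : HasDerivAt (deriv M) (deriv (deriv M) r) r :=
    ((hM.derivWithin (m := 1) (by norm_num)).differentiableAt one_ne_zero).hasDerivAt
  refine (((hasDerivAt_id' r).sub hM₁).sub ((hasDerivAt_id' r).mul hM₂)).congr_deriv ?_
  ring

variable {ρ τ : ℝ → ℝ} {ρ' τ' t : ℝ}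

lemma hasDerivAt_sqrtDelta_comp (hρ : HasDerivAt ρ ρ' t) (hM : DifferentiableAt ℝ M (ρ t))
    (h : 0 < delta a M (ρ t)) :
    HasDerivAt (fun t => sqrtDelta a M (ρ t))
      (halfDerivDelta M (ρ t) * ρ' / sqrtDelta a M (ρ t)) t := by
  have hΔ := ((hρ.fun_pow 2).sub (((hM.hasDerivAt.comp t hρ).const_mul 2).mul hρ)).add_const (a ^ 2)
  refine (hΔ.sqrt h.ne').congr_deriv ?_
  change _ / (2 * sqrtDelta a M (ρ t)) = _
  have hp := sqrtDelta_pos h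
  simp only [halfDerivDelta, Function.comp_apply]
  field_simp
  ring

lemma hasDerivAt_sqrtSigma_comp (hρ : HasDerivAt ρ ρ' t) (hτ : HasDerivAt τ τ' t)
    (h : 0 < sigma a (ρ t) (τ t)) :
    HasDerivAt (fun t => sqrtSigma a (ρ t) (τ t))
      ((ρ t * ρ' - a ^ 2 * Real.cos (τ t) * Real.sin (τ t) * τ') / sqrtSigma a (ρ t) (τ t)) t := by
  have hσ := (hρ.fun_pow 2).add ((hτ.cos.fun_pow 2).const_mul (a ^ 2))
  refine (hσ.sqrt h.ne').congr_deriv ?_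
  change _ / (2 * sqrtSigma a (ρ t) (τ t)) = _
  have hq := sqrtSigma_pos h
  field_simp
  ring

end Derivatives

lemma isOpen_frameDomain (a : ℝ) (M : ℝ → ℝ) : IsOpen (frameDomain a M) := by
  rw [isOpen_iff_mem_nhds]
  rintro x ⟨hM, hΔ, hθ₀, hθ₁, hσ⟩
  have hr : ContinuousAt (fun y : Coord => y 1) x := continuousAt_apply 1 x
  have hθ : ContinuousAt (fun y : Coord => y 2) x := continuousAt_apply 2 x
  have hMr : ContinuousAt (fun y : Coord => M (y 1)) x :=
    ContinuousAt.comp (f := fun y : Coord => y 1) hM.continuousAt hr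
  have hΔc : ContinuousAt (fun y : Coord => delta a M (y 1)) x :=
    ((hr.pow 2).sub ((continuousAt_const.mul hMr).mul hr)).add continuousAt_const
  have hσc : ContinuousAt (fun y : Coord => sigma a (y 1) (y 2)) x := by
    unfold sigma
    fun_prop
  filter_upwards [hr.eventually (hM.eventually (by simp)), hΔc.eventually_const_lt hΔ,
    hθ.eventually_const_lt hθ₀, hθ.eventually_lt_const hθ₁, hσc.eventually_const_lt hσ]
    with y hMy hΔy hθ₀y hθ₁y hσy
  exact ⟨hMy, hΔy, hθ₀y, hθ₁y, hσy⟩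

section FrameDomain

variable {a : ℝ} {M : ℝ → ℝ} {x : Coord}

lemma sin_pos_of_mem_frameDomain (h : x ∈ frameDomain a M) : 0 < Real.sin (x 2) :=
  Real.sin_pos_of_pos_of_lt_pi h.2.2.1 h.2.2.2.1

lemma contDiffAt_sqrtDelta (h : x ∈ frameDomain a M) :
    ContDiffAt ℝ 2 (fun y : Coord => sqrtDelta a M (y 1)) x := by
  have hM : ContDiffAt ℝ 2 (fun y : Coord => M (y 1)) x :=
    ContDiffAt.comp (f := fun y : Coord => y 1) x h.1 (by fun_prop)
  have hr : ContDiffAt ℝ 2 (fun y : Coord => y 1) x := by fun_prop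
  exact ((((hr.pow 2).sub ((contDiffAt_const.mul hM).mul hr)).add contDiffAt_const)).sqrt h.2.1.ne'

lemma contDiffAt_sqrtSigma (h : x ∈ frameDomain a M) :
    ContDiffAt ℝ 2 (fun y : Coord => sqrtSigma a (y 1) (y 2)) x := by
  refine ContDiffAt.sqrt ?_ h.2.2.2.2.ne'
  unfold sigma
  fun_prop

lemma differentiableAt_halfDerivDelta (h : x ∈ frameDomain a M) :
    DifferentiableAt ℝ (fun y : Coord => halfDerivDelta M (y 1)) x :=
  DifferentiableAt.comp (f := fun y : Coord => y 1) x
    (hasDerivAt_halfDerivDelta h.1).differentiableAt (by fun_prop)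

lemma contDiffAt_kerrCoframe (h : x ∈ frameDomain a M) (i j : Fin 4) :
    ContDiffAt ℝ 2 (fun y => kerrCoframe a M y i j) x := by
  have hp := contDiffAt_sqrtDelta h
  have hq := contDiffAt_sqrtSigma h
  have hp0 := (sqrtDelta_pos h.2.1).ne'
  have hq0 := (sqrtSigma_pos h.2.2.2.2).ne'
  fin_cases i <;> fin_cases j <;> simp only [kerrCoframe, kerrCoframeOf, of_apply, Fin.zero_eta,
    Fin.mk_one, Fin.reduceFinMk, cons_val] <;> fun_prop (disch := assumption)

lemma entryDifferentiableAt_kerrFrame (h : x ∈ frameDomain a M) :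
    EntryDifferentiableAt (kerrFrame a M) x := by
  have hp := (contDiffAt_sqrtDelta h).differentiableAt two_ne_zero
  have hq := (contDiffAt_sqrtSigma h).differentiableAt two_ne_zero
  have hq0 := (sqrtSigma_pos h.2.2.2.2).ne'
  have hpq0 := mul_ne_zero (sqrtDelta_pos h.2.1).ne' hq0
  have hqs0 := mul_ne_zero hq0 (sin_pos_of_mem_frameDomain h).ne'
  intro i j
  fin_cases i <;> fin_cases j <;> simp only [kerrFrame, kerrFrameOf, of_apply, Fin.zero_eta,
    Fin.mk_one, Fin.reduceFinMk, cons_val] <;> fun_prop (disch := assumption)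

lemma entryDifferentiableAt_kerrConn (h : x ∈ frameDomain a M) (C : Fin 4) :
    EntryDifferentiableAt (kerrConn a M C) x := by
  have hp := (contDiffAt_sqrtDelta h).differentiableAt two_ne_zero
  have hq := (contDiffAt_sqrtSigma h).differentiableAt two_ne_zero
  have hd := differentiableAt_halfDerivDelta h
  have hq0 := (sqrtSigma_pos h.2.2.2.2).ne'
  have hpq0 := mul_ne_zero (sqrtDelta_pos h.2.1).ne' hq0
  have hsq0 := mul_ne_zero (sin_pos_of_mem_frameDomain h).ne' hq0
  have hq30 := pow_ne_zero 3 hq0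
  refine entryDifferentiableAt_connForm (differentiableAt_pi.mpr fun i => ?_) C
  fin_cases i <;> simp only [kerrConnCoeff, Fin.zero_eta, Fin.mk_one, Fin.reduceFinMk, cons_val] <;>
    fun_prop (disch := assumption)

variable {γ : ℝ → Coord} {v : Coord} {t : ℝ}

lemma hasDerivAt_kerrCoframe_comp (hγ : HasDerivAt γ v t) (h : γ t ∈ frameDomain a M)
    (A ν : Fin 4) :
    HasDerivAt (fun t => kerrCoframe a M (γ t) A ν) (kerrCoframeDeriv a M v (γ t) A ν) t := by
  have hr := hasDerivAt_pi.mp hγ 1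
  have hθ := hasDerivAt_pi.mp hγ 2
  exact hasDerivAt_kerrCoframeOf a
    (hasDerivAt_sqrtDelta_comp hr (h.1.differentiableAt two_ne_zero) h.2.1)
    (hasDerivAt_sqrtSigma_comp hr hθ h.2.2.2.2) hr hθ.sin
    (sqrtDelta_pos h.2.1).ne' (sqrtSigma_pos h.2.2.2.2).ne' A ν

lemma hasDerivAt_kerrConn_comp (hγ : HasDerivAt γ v t) (h : γ t ∈ frameDomain a M)
    (C A B : Fin 4) :
    HasDerivAt (fun t => kerrConn a M C (γ t) A B) (connForm (kerrConnDeriv a M v (γ t)) C A B)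
      t := by
  have hr := hasDerivAt_pi.mp hγ 1
  have hθ := hasDerivAt_pi.mp hγ 2
  have hp := hasDerivAt_sqrtDelta_comp hr (h.1.differentiableAt two_ne_zero) h.2.1
  have hq := hasDerivAt_sqrtSigma_comp hr hθ h.2.2.2.2
  have hd : HasDerivAt (fun t => halfDerivDelta M (γ t 1)) _ t :=
    HasDerivAt.comp (h := fun t => γ t 1) t (hasDerivAt_halfDerivDelta h.1) hr
  exact hasDerivAt_connForm (hasDerivAt_kerrConnCoeff a hp hq hr hθ.sin hθ.cos hd
    (sqrtDelta_pos h.2.1).ne' (sqrtSigma_pos h.2.2.2.2).ne' (sin_pos_of_mem_frameDomain h).ne')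
    C A B

lemma pderivMat_kerrCoframe (h : x ∈ frameDomain a M) (μ : Fin 4) :
    pderivMat μ (kerrCoframe a M) x = kerrCoframeDeriv a M (Pi.single μ 1) x := by
  ext A ν
  have hx : Function.update x μ (x μ) = x := Function.update_eq_self μ x
  have := hasDerivAt_kerrCoframe_comp (hasDerivAt_update_coord μ x) (hx.symm ▸ h) A ν
  rw [hx] at this
  exact this.deriv

lemma pderivMat_kerrConn (h : x ∈ frameDomain a M) (μ C : Fin 4) :
    pderivMat μ (kerrConn a M C) x = connForm (kerrConnDeriv a M (Pi.single μ 1) x) C := by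
  ext A B
  have hx : Function.update x μ (x μ) = x := Function.update_eq_self μ x
  have := hasDerivAt_kerrConn_comp (hasDerivAt_update_coord μ x) (hx.symm ▸ h) C A B
  rw [hx] at this
  exact this.deriv

end FrameDomain

section FrameDomain

variable {a : ℝ} {M : ℝ → ℝ} {x : Coord}

lemma kerrCoframe_mul_kerrFrame (h : x ∈ frameDomain a M) :
    kerrCoframe a M x * kerrFrame a M x = 1 := by
  have hp0 := (sqrtDelta_pos h.2.1).ne'
  have hq0 := (sqrtSigma_pos h.2.2.2.2).ne'
  have hs0 := (sin_pos_of_mem_frameDomain h).ne'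
  have hq2 : sqrtSigma a (x 1) (x 2) ^ 2 = x 1 ^ 2 + a ^ 2 * Real.cos (x 2) ^ 2 :=
    sqrtSigma_sq h.2.2.2.2
  have hsc := Real.sin_sq (x 2)
  simp only [kerrCoframe, kerrFrame]
  generalize sqrtSigma a (x 1) (x 2) = q at *
  generalize sqrtDelta a M (x 1) = p at *
  generalize Real.sin (x 2) = s at *
  ext i j
  fin_cases i <;> fin_cases j <;>
    simp [kerrCoframeOf, kerrFrameOf, mul_apply, Fin.sum_univ_four] <;> field_simp <;>
    first | (ring_nf; done) | (simp only [hq2, hsc]; ring)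

lemma metric_eq_kerrCoframe (h : x ∈ frameDomain a M) :
    metric a M x = (kerrCoframe a M x)ᵀ * minkowski * kerrCoframe a M x := by
  have hp0 := (sqrtDelta_pos h.2.1).ne'
  have hq0 := (sqrtSigma_pos h.2.2.2.2).ne'
  simp only [kerrCoframe, metric, ← sqrtDelta_sq h.2.1, ← sqrtSigma_sq h.2.2.2.2]
  generalize sqrtSigma a (x 1) (x 2) = q at *
  generalize sqrtDelta a M (x 1) = p at *
  ext i j
  fin_cases i <;> fin_cases j <;>
    simp [kerrCoframeOf, minkowski, mul_apply, Fin.sum_univ_four, diagonal_apply, formT, formPhi,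
      formR, formTheta] <;> field_simp <;> ring

set_option maxHeartbeats 1000000 in
-- the algebra of 24 components
lemma kerrFrame_torsion_of_lt (h : x ∈ frameDomain a M) {μ ν : Fin 4} (hμν : μ < ν) (A : Fin 4) :
    (pderivMat μ (kerrCoframe a M) x
        + connMat (kerrCoframe a M) (kerrConn a M) μ x * kerrCoframe a M x) A ν =
      (pderivMat ν (kerrCoframe a M) x
        + connMat (kerrCoframe a M) (kerrConn a M) ν x * kerrCoframe a M x) A μ := by
  have hp0 := (sqrtDelta_pos h.2.1).ne'
  have hq0 := (sqrtSigma_pos h.2.2.2.2).ne'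
  have hs0 := (sin_pos_of_mem_frameDomain h).ne'
  have hq2 : sqrtSigma a (x 1) (x 2) ^ 2 = x 1 ^ 2 + a ^ 2 * Real.cos (x 2) ^ 2 :=
    sqrtSigma_sq h.2.2.2.2
  have hsc := Real.sin_sq (x 2)
  simp only [pderivMat_kerrCoframe h, connMat, kerrCoframe, kerrConn, kerrCoframeDeriv]
  generalize sqrtSigma a (x 1) (x 2) = q at *
  generalize sqrtDelta a M (x 1) = p at *
  generalize Real.sin (x 2) = s at *
  fin_cases μ <;> fin_cases ν <;> (first | exact absurd hμν (by decide) | skip) <;>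
    fin_cases A <;>
    simp [kerrCoframeDiff, kerrCoframeOf, connForm, kerrConnCoeff, Fin.sum_univ_four] <;>
    field_simp <;>
    first | (ring_nf; done) | (simp only [hq2, hsc]; ring)

lemma isMovingFrame_kerr (a : ℝ) (M : ℝ → ℝ) :
    IsMovingFrame (frameDomain a M) (metric a M) minkowski (kerrCoframe a M) (kerrFrame a M)
      (kerrConn a M) where
  isOpen := isOpen_frameDomain a M
  eta_mul_eta := by
    rw [minkowski, diagonal_mul_diagonal, ← diagonal_one]
    congr 1
    ext i
    fin_cases i <;> simp
  eta_symm := diagonal_transpose _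
  metric_eq _ h := metric_eq_kerrCoframe h
  mul_dual _ h := kerrCoframe_mul_kerrFrame h
  contDiffAt _ h := contDiffAt_kerrCoframe h
  differentiableAt_dual _ h := entryDifferentiableAt_kerrFrame h
  differentiableAt_conn _ h := entryDifferentiableAt_kerrConn h
  skew _ _ := connForm_skew _
  torsion y h μ ν A := by
    rcases lt_trichotomy μ ν with hμν | rfl | hμν
    · exact kerrFrame_torsion_of_lt h hμν A
    · rfl
    · exact (kerrFrame_torsion_of_lt h hμν A).symm

end FrameDomain

/-- The derivatives of the coefficients of `kerrConn` along the second frame vector. -/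
def kerrConnDeriv₁ (a : ℝ) (M : ℝ → ℝ) (x : Coord) : Fin 6 → ℝ :=
  kerrConnDeriv a M (Pi.single 1 (sqrtDelta a M (x 1) / sqrtSigma a (x 1) (x 2))) x

/-- The derivatives of the coefficients of `kerrConn` along the third frame vector. -/
def kerrConnDeriv₂ (a : ℝ) (M : ℝ → ℝ) (x : Coord) : Fin 6 → ℝ :=
  kerrConnDeriv a M (Pi.single 2 (1 / sqrtSigma a (x 1) (x 2))) x

section FrameDomain

variable {a : ℝ} {M : ℝ → ℝ} {x : Coord}

lemma connForm_smul (k : Fin 6 → ℝ) (b : ℝ) (C : Fin 4) :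
    connForm (b • k) C = b • connForm k C := by
  ext A B
  fin_cases C <;> fin_cases A <;> fin_cases B <;> simp [connForm]

lemma kerrConnDeriv_smul (a : ℝ) (M : ℝ → ℝ) (b : ℝ) (v x : Coord) :
    kerrConnDeriv a M (b • v) x = b • kerrConnDeriv a M v x := by
  ext i
  fin_cases i <;> simp [kerrConnDeriv, kerrConnCoeffDiff] <;> ring

lemma connForm_zero (C : Fin 4) : connForm 0 C = 0 := by
  simpa using connForm_smul 0 0 C

lemma kerrConnDeriv_eq_zero (a : ℝ) (M : ℝ → ℝ) {v : Coord} (x : Coord) (h₁ : v 1 = 0)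
    (h₂ : v 2 = 0) : kerrConnDeriv a M v x = 0 := by
  ext i
  fin_cases i <;> simp [kerrConnDeriv, kerrConnCoeffDiff, h₁, h₂]

lemma pderivMat_kerrConn_eq_sum (h : x ∈ frameDomain a M) (μ D : Fin 4) :
    pderivMat μ (kerrConn a M D) x = ∑ C, kerrCoframe a M x C μ •
      (![0, connForm (kerrConnDeriv₁ a M x), connForm (kerrConnDeriv₂ a M x), 0] :
        Fin 4 → Fin 4 → Mat) C D := by
  have hp0 := (sqrtDelta_pos h.2.1).ne'
  have hq0 := (sqrtSigma_pos h.2.2.2.2).ne'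
  rw [pderivMat_kerrConn h]
  fin_cases μ <;> simp [Fin.sum_univ_four, kerrCoframe, kerrCoframeOf, ← connForm_smul,
    kerrConnDeriv₁, kerrConnDeriv₂, ← kerrConnDeriv_smul, ← Pi.single_smul, hp0, hq0,
    kerrConnDeriv_eq_zero, connForm_zero]

/-- The frame components of the curvature of the Kerr-like metric: those of `R_{0101}`, `R_{2323}`,
`R_{0202} = R_{0303}` and half of `R_{0123}`. They are written in terms of `m = r M` and its
derivatives, and of `a cos θ`. -/
def kerrCurvCoeff (a : ℝ) (M : ℝ → ℝ) (x : Coord) : Fin 4 → ℝ :=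
  let r := x 1
  let c := a * Real.cos (x 2)
  let σ := sigma a (x 1) (x 2)
  let m := r * M r
  let m' := M r + r * deriv M r
  let m'' := 2 * deriv M r + r * deriv (deriv M) r
  ![-m'' / σ + 4 * r * m' / σ ^ 2 - 2 * m * (3 * r ^ 2 - c ^ 2) / σ ^ 3,
    2 * m * (r ^ 2 - 3 * c ^ 2) / σ ^ 3,
    -(r * m') / σ ^ 2 + 2 * m * (r ^ 2 - c ^ 2) / σ ^ 3,
    m' * c / σ ^ 2 - 4 * m * r * c / σ ^ 3]

/-- The Riemann tensor of the Kerr-like metric in its orthonormal frame. -/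
def kerrCurv (a : ℝ) (M : ℝ → ℝ) (x : Coord) : Fin 4 → Fin 4 → Fin 4 → Fin 4 → ℝ :=
  bivForm (curvMatrix (kerrCurvCoeff a M x))

set_option maxHeartbeats 1000000 in
-- the algebra of 36 matrix entries
lemma connCurv_kerr (h : x ∈ frameDomain a M) :
    connCurv (kerrConnCoeff a (sqrtDelta a M (x 1)) (sqrtSigma a (x 1) (x 2)) (x 1)
        (Real.sin (x 2)) (Real.cos (x 2)) (halfDerivDelta M (x 1)))
      (kerrConnDeriv₁ a M x) (kerrConnDeriv₂ a M x) = curvMatrix (kerrCurvCoeff a M x) := by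
  have hp0 := (sqrtDelta_pos h.2.1).ne'
  have hq0 := (sqrtSigma_pos h.2.2.2.2).ne'
  have hs0 := (sin_pos_of_mem_frameDomain h).ne'
  have hp2 : sqrtDelta a M (x 1) ^ 2 = x 1 ^ 2 - 2 * M (x 1) * x 1 + a ^ 2 := sqrtDelta_sq h.2.1
  have hq2 : sqrtSigma a (x 1) (x 2) ^ 2 = x 1 ^ 2 + a ^ 2 * Real.cos (x 2) ^ 2 :=
    sqrtSigma_sq h.2.2.2.2
  have hsc := Real.sin_sq (x 2)
  simp only [kerrConnDeriv₁, kerrConnDeriv₂, kerrConnDeriv, kerrCurvCoeff, halfDerivDelta,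
    ← sqrtSigma_sq h.2.2.2.2]
  generalize sqrtSigma a (x 1) (x 2) = q at *
  generalize sqrtDelta a M (x 1) = p at *
  generalize Real.sin (x 2) = s at *
  ext i j
  fin_cases i <;> fin_cases j <;>
    simp [connCurv, curvMatrix, kerrConnCoeff, kerrConnCoeffDiff] <;> field_simp <;>
    first | (ring_nf; done) | (simp only [hp2, hq2, hsc]; ring)

end FrameDomain

section FrameDomain

variable {a : ℝ} {M : ℝ → ℝ} {x : Coord}

lemma minkowski_mul_riemannMat_metric (h : x ∈ frameDomain a M) (μ ν : Fin 4) :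
    minkowski * (kerrCoframe a M x * riemannMat (metric a M) x μ ν) =
      (∑ C, ∑ D, (kerrCoframe a M x C μ * kerrCoframe a M x D ν) •
        of fun A B => kerrCurv a M x A B C D) * kerrCoframe a M x := by
  have hcurv : ∀ C D, minkowski * frameCurv (fun C => kerrConn a M C x)
      ![0, connForm (kerrConnDeriv₁ a M x), connForm (kerrConnDeriv₂ a M x), 0] C D =
        of fun A B => kerrCurv a M x A B C D := fun C D => by
    ext A B
    rw [of_apply, kerrCurv, ← connCurv_kerr h]
    exact minkowski_mul_frameCurv _ _ _ A B C D
  rw [(isMovingFrame_kerr a M).mul_riemannMat_eq_frameCurv h (pderivMat_kerrConn_eq_sum h),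
    ← Matrix.mul_assoc]
  simp only [Matrix.mul_sum, Matrix.mul_smul, hcurv]

theorem riemann_metric (h : x ∈ frameDomain a M) (i j k l : Fin 4) :
    riemann (metric a M) x i j k l = ∑ A, ∑ B, ∑ C, ∑ D,
      kerrCoframe a M x A i * kerrCoframe a M x B j * kerrCoframe a M x C k *
        kerrCoframe a M x D l * kerrCurv a M x A B C D := by
  have hriemann : riemann (metric a M) x i j k l =
      (metric a M x * riemannMat (metric a M) x k l) i j := by
    rw [riemann, mul_apply]
    rfl
  rw [hriemann, metric_eq_kerrCoframe h, Matrix.mul_assoc, Matrix.mul_assoc,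
    minkowski_mul_riemannMat_metric h]
  rw [mul_apply]
  refine Finset.sum_congr rfl fun A _ => ?_
  rw [mul_apply, Finset.mul_sum]
  refine Finset.sum_congr rfl fun B _ => ?_
  simp only [Matrix.sum_apply, Finset.sum_mul, Finset.mul_sum, transpose_apply, Matrix.smul_apply,
    of_apply, smul_eq_mul]
  exact Finset.sum_congr rfl fun C _ => Finset.sum_congr rfl fun D _ => by ring

end FrameDomain

/-! ### Tensors in a frame -/

section Pullback

variable {S V W A m n p ι κ P : Type*} [CommRing S] [AddCommGroup V] [Module S V]
  [AddCommGroup W] [Module S W] [CommRing A] [Algebra S A] [Fintype ι] [Fintype κ] [Fintype P]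

/-- The action of a matrix on tensors whose slots are labelled by `ι`, as a matrix indexed by
multi-indices. -/
def tensorPow (E : Matrix m n S) : Matrix (ι → m) (ι → n) S :=
  of fun J j => ∏ l, E (J l) (j l)

lemma tensorPow_mul_apply [DecidableEq ι] [Fintype n] (E : Matrix m n S) (F : Matrix n p S)
    (J : ι → m) (K : ι → p) :
    tensorPow (E * F) J K = ∑ j, tensorPow E J j * tensorPow F j K := by
  simp only [tensorPow, of_apply, mul_apply, ← Finset.prod_mul_distrib]
  rw [Finset.prod_univ_sum, Fintype.piFinset_univ]

lemma tensorPow_one_apply [DecidableEq n] (J K : ι → n) :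
    tensorPow (1 : Matrix n n S) J K = if J = K then 1 else 0 := by
  simp only [tensorPow, of_apply, one_apply, Finset.prod_ite_zero, Finset.prod_const_one,
    Finset.mem_univ, true_imp_iff, funext_iff]

lemma tensorPow_sumElim (E : Matrix m n S) (J : ι → m) (K : κ → m) (j : ι → n) (k : κ → n) :
    tensorPow E (Sum.elim J K) (Sum.elim j k) = tensorPow E J j * tensorPow E K k := by
  simp only [tensorPow, of_apply, Fintype.prod_sum_type, Sum.elim_inl, Sum.elim_inr]

variable [DecidableEq ι] [DecidableEq κ] [Fintype m] {E : Matrix m n S}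
  {F : Matrix n m S}

/-- The tensor with components `T` has the components `Tf` in the frame whose dual coframe is given
by the rows of `E`. A tensor is a function of a multi-index. -/
def IsPullback (E : Matrix m n S) (T : (ι → n) → V) (Tf : (ι → m) → V) : Prop :=
  ∀ j, T j = ∑ J, tensorPow E J j • Tf J

namespace IsPullback

variable {T U : (ι → n) → V} {Tf Uf : (ι → m) → V}

lemma add (hT : IsPullback E T Tf) (hU : IsPullback E U Uf) :
    IsPullback E (fun j => T j + U j) (fun J => Tf J + Uf J) := fun j => by
  simp only [hT j, hU j, smul_add, Finset.sum_add_distrib]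

lemma sub (hT : IsPullback E T Tf) (hU : IsPullback E U Uf) :
    IsPullback E (fun j => T j - U j) (fun J => Tf J - Uf J) := fun j => by
  simp only [hT j, hU j, smul_sub, Finset.sum_sub_distrib]

lemma map (f : V →ₗ[S] W) (hT : IsPullback E T Tf) :
    IsPullback E (fun j => f (T j)) (fun J => f (Tf J)) := fun j => by
  simp only [hT j, map_sum, map_smul]

lemma const_mul {T : (ι → n) → A} {Tf : (ι → m) → A} (c : A) (hT : IsPullback E T Tf) :
    IsPullback E (fun j => c * T j) (fun J => c * Tf J) :=
  hT.map (LinearMap.mulLeft S c)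

lemma prod {X : P → (ι → n) → A} {Xf : P → (ι → m) → A} (hX : ∀ p, IsPullback E (X p) (Xf p))
    (e : P × ι ≃ κ) :
    IsPullback E (fun j : κ → n => ∏ p, X p fun i => j (e (p, i)))
      (fun J => ∏ p, Xf p fun i => J (e (p, i))) := by
  classical
  intro j
  simp only [hX _ _]
  rw [Finset.prod_univ_sum, Fintype.piFinset_univ]
  refine Fintype.sum_equiv ((Equiv.curry P ι m).symm.trans (e.arrowCongr (Equiv.refl _)))
    _ _ fun J => ?_
  have happly : ∀ p i, ((Equiv.curry P ι m).symm.trans (e.arrowCongr (Equiv.refl _))) J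
      (e (p, i)) = J p i := fun p i => by simp [Equiv.arrowCongr, Function.uncurry]
  simp only [happly, tensorPow, of_apply]
  rw [← Equiv.prod_comp e, Fintype.prod_prod_type]
  simp only [happly, Algebra.smul_def, Finset.prod_mul_distrib, map_prod]

lemma mul {X Y : (ι → n) → A} {Xf Yf : (ι → m) → A} (hX : IsPullback E X Xf)
    (hY : IsPullback E Y Yf) (e : Fin 2 × ι ≃ κ) :
    IsPullback E (fun j => X (fun i => j (e (0, i))) * Y fun i => j (e (1, i)))
      (fun J => Xf (fun i => J (e (0, i))) * Yf fun i => J (e (1, i))) := by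
  have h := prod (X := ![X, Y]) (Xf := ![Xf, Yf])
    (Fin.forall_fin_two.mpr ⟨hX, hY⟩) e
  simp only [Fin.prod_univ_two] at h
  exact h

lemma reindex {T : (ι → n) → A} {Tf : (ι → m) → A} (hT : IsPullback E T Tf) (e : ι ≃ κ) :
    IsPullback E (fun j => T fun i => j (e i)) (fun J => Tf fun i => J (e i)) := by
  have h := prod (P := Unit) (fun _ => hT) ((Equiv.punitProd ι).trans e)
  simp only [Fintype.prod_unique] at h
  exact h

end IsPullback

lemma isPullback_mul_iff [Fintype p] (E : Matrix m p S) (E' : Matrix p n S) {T : (ι → n) → V}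
    {Tf : (ι → m) → V} :
    IsPullback (E * E') T Tf ↔ IsPullback E' T fun K => ∑ J, tensorPow E J K • Tf J := by
  refine forall_congr' fun j => ?_
  simp only [tensorPow_mul_apply, Finset.sum_smul, Finset.smul_sum, smul_smul]
  rw [Finset.sum_comm]
  simp only [mul_comm]

namespace IsPullback

lemma raise [DecidableEq m] [Fintype n] (hEF : E * F = 1) (H : Matrix m m S) {T : (ι → n) → V}
    {Tf : (ι → m) → V} (hT : IsPullback E T Tf) :
    IsPullback Fᵀ (fun j => ∑ j', tensorPow (F * H * Fᵀ) j j' • T j')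
      (fun J => ∑ J', tensorPow H J J' • Tf J') := by
  have hE : E * (F * H * Fᵀ)ᵀ = Hᵀ * Fᵀ := by
    rw [transpose_mul, transpose_mul, transpose_transpose, ← Matrix.mul_assoc,
      ← Matrix.mul_assoc, hEF, Matrix.one_mul]
  refine (isPullback_mul_iff Hᵀ Fᵀ).mp (hE ▸ (isPullback_mul_iff E (F * H * Fᵀ)ᵀ).mpr ?_)
  intro j
  simp only [← hT _]
  rfl

lemma sum_mul [DecidableEq m] [Fintype n] (hEF : E * F = 1) {T U : (ι → n) → A}
    {Tf Uf : (ι → m) → A} (hT : IsPullback E T Tf) (hU : IsPullback Fᵀ U Uf) :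
    ∑ j, T j * U j = ∑ J, Tf J * Uf J := by
  have hdual : ∀ J K : ι → m, ∑ j, tensorPow E J j * tensorPow Fᵀ K j = if J = K then 1 else 0 :=
    fun J K => by
      rw [← tensorPow_one_apply (S := S), ← hEF, tensorPow_mul_apply]
      rfl
  calc ∑ j, T j * U j
      = ∑ j, ∑ J, ∑ K, (tensorPow E J j * tensorPow Fᵀ K j) • (Tf J * Uf K) := by
        refine Finset.sum_congr rfl fun j _ => ?_
        rw [hT j, hU j, Finset.sum_mul_sum]
        simp only [smul_mul_smul_comm]
    _ = ∑ J, ∑ K, (∑ j, tensorPow E J j * tensorPow Fᵀ K j) • (Tf J * Uf K) := by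
        rw [Finset.sum_comm]
        refine Finset.sum_congr rfl fun J _ => ?_
        rw [Finset.sum_comm]
        simp only [Finset.sum_smul]
    _ = ∑ J, Tf J * Uf J := by
        simp only [hdual, ite_smul, one_smul, zero_smul, Finset.sum_ite_eq, Finset.mem_univ,
          if_true]

lemma contract [DecidableEq m] [Fintype n] (hEF : E * F = 1) {T : (ι ⊕ κ → n) → A}
    {Tf : (ι ⊕ κ → m) → A} {U : (ι → n) → A} {Uf : (ι → m) → A} (hT : IsPullback E T Tf)
    (hU : IsPullback Fᵀ U Uf) :
    IsPullback E (fun k => ∑ j, T (Sum.elim j k) * U j)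
      (fun K => ∑ J, Tf (Sum.elim J K) * Uf J) := by
  intro k
  have hslice : IsPullback E (fun j => T (Sum.elim j k))
      (fun J => ∑ K, tensorPow E K k • Tf (Sum.elim J K)) := fun j => by
    refine (hT (Sum.elim j k)).trans ?_
    rw [← (Equiv.sumArrowEquivProdArrow ι κ m).symm.sum_comp, Fintype.sum_prod_type]
    refine Finset.sum_congr rfl fun J _ => ?_
    rw [Finset.smul_sum]
    refine Finset.sum_congr rfl fun K _ => ?_
    rw [smul_smul, ← tensorPow_sumElim]
    rfl
  simp only [hslice.sum_mul hEF hU, Finset.sum_mul, Finset.smul_sum, smul_mul_assoc]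
  exact Finset.sum_comm

end IsPullback

end Pullback

/-! ### Tensors of rank two and four -/

section Uncurry

variable {S V n : Type*}

/-- The multi-index form of a tensor of rank two. -/
def uncurry₂ (T : n → n → V) (j : Fin 2 → n) : V := T (j 0) (j 1)

/-- The multi-index form of a tensor of rank four. -/
def uncurry₄ (T : n → n → n → n → V) (j : Fin 4 → n) : V := T (j 0) (j 1) (j 2) (j 3)

lemma sum_multiIndex_two [Fintype n] [AddCommMonoid V] (f : (Fin 2 → n) → V) :
    ∑ j, f j = ∑ a, ∑ b, f ![a, b] := by
  rw [← (finTwoArrowEquiv n).symm.sum_comp, Fintype.sum_prod_type]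
  rfl

lemma sum_multiIndex_four [Fintype n] [AddCommMonoid V] (f : (Fin 4 → n) → V) :
    ∑ j, f j = ∑ a, ∑ b, ∑ c, ∑ d, f ![a, b, c, d] := by
  simp only [← (Fin.consEquiv fun _ => n).sum_comp, Fintype.sum_prod_type, Fintype.sum_unique]
  rfl

variable [CommRing S] [AddCommGroup V] [Module S V] [Fintype n]

lemma isPullback_uncurry₄ {E : Matrix n n S} {T Tf : n → n → n → n → V}
    (h : ∀ a b c d, T a b c d =
      ∑ A, ∑ B, ∑ C, ∑ D, (E A a * E B b * E C c * E D d) • Tf A B C D) :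
    IsPullback E (uncurry₄ T) (uncurry₄ Tf) := by
  intro j
  simp only [sum_multiIndex_four, tensorPow, of_apply, Fin.prod_univ_four]
  exact h (j 0) (j 1) (j 2) (j 3)

lemma isPullback_transpose_mul_mul (E H : Matrix n n S) :
    IsPullback E (uncurry₂ fun a b => (Eᵀ * H * E) a b) (uncurry₂ fun A B => H A B) := by
  intro j
  simp only [sum_multiIndex_two, tensorPow, of_apply, Fin.prod_univ_two, uncurry₂, mul_apply,
    Finset.sum_mul, transpose_apply, smul_eq_mul]
  rw [Finset.sum_comm]
  exact Finset.sum_congr rfl fun A _ => Finset.sum_congr rfl fun B _ => mul_right_comm _ _ _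

end Uncurry

/-! ### Curvature invariants in an orthonormal frame -/

/-- The components of a tensor of rank four. -/
abbrev Tensor₄ : Type := Fin 4 → Fin 4 → Fin 4 → Fin 4 → ℝ

/-- The Ricci tensor in an orthonormal frame. -/
def frameRicci (R : Tensor₄) (B D : Fin 4) : ℝ :=
  ∑ A, ∑ C, R A B C D * minkowski A C

/-- The curvature scalar in an orthonormal frame. -/
def frameScalar (R : Tensor₄) : ℝ :=
  ∑ A, ∑ B, frameRicci R A B * minkowski A B

/-- The trace-free Ricci tensor in an orthonormal frame. -/
def frameTfRicci (R : Tensor₄) (A B : Fin 4) : ℝ :=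
  frameRicci R A B - frameScalar R / 4 * minkowski A B

/-- The trace-free Ricci tensor in an orthonormal frame, with both indices raised. -/
def frameTfRicciUp (R : Tensor₄) (A B : Fin 4) : ℝ :=
  ∑ C, ∑ D, minkowski A C * minkowski B D * frameTfRicci R C D

/-- The Weyl tensor in an orthonormal frame. -/
def frameWeyl (R : Tensor₄) (A B C D : Fin 4) : ℝ :=
  R A B C D
    - (1 / 2) * (minkowski A C * frameRicci R B D - minkowski A D * frameRicci R B C
      - minkowski B C * frameRicci R A D + minkowski B D * frameRicci R A C)
    + frameScalar R / 6 * (minkowski A C * minkowski B D - minkowski A D * minkowski B C)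

/-- The dual Weyl tensor in an orthonormal frame of orientation `o = ±1`. -/
def frameWeylDual (o : ℝ) (R : Tensor₄) (A B C D : Fin 4) : ℝ :=
  (1 / 2) * ∑ M, ∑ N, ∑ M', ∑ N',
    o * altSymbol A B M N * frameWeyl R M' N' C D * (minkowski M M' * minkowski N N')

/-- The tensor `(C + i *C) / 2` in an orthonormal frame of orientation `o = ±1`. -/
def frameWeylBar (o : ℝ) (R : Tensor₄) (A B C D : Fin 4) : ℂ :=
  ((frameWeyl R A B C D : ℂ) + Complex.I * (frameWeylDual o R A B C D : ℂ)) / 2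

/-- The invariant `I₆` in an orthonormal frame. -/
def frameInvI6 (R : Tensor₄) : ℝ :=
  (1 / 12) * ∑ A, ∑ B, frameTfRicci R A B * frameTfRicciUp R A B

/-- The invariant `I` in an orthonormal frame of orientation `o = ±1`. -/
def frameInvI (o : ℝ) (R : Tensor₄) : ℂ :=
  (1 / 24) * ∑ A, ∑ B, ∑ C, ∑ D, frameWeylBar o R A B C D *
    ∑ A', ∑ B', ∑ C', ∑ D',
      ((minkowski A A' * minkowski B B' * minkowski C C' * minkowski D D' : ℝ) : ℂ)
        * frameWeylBar o R A' B' C' D'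

/-- The invariant `K` in an orthonormal frame of orientation `o = ±1`. -/
def frameInvK (o : ℝ) (R : Tensor₄) : ℂ :=
  (1 / 4) * ∑ A, ∑ B, ∑ C, ∑ D,
    frameWeylBar o R A C D B * ((frameTfRicciUp R C D * frameTfRicciUp R A B : ℝ) : ℂ)

/-- The complete contraction that a scheme describes, in an orthonormal frame of orientation
`o = ±1`. -/
def ContractionScheme.frameEval (s : ContractionScheme) (o : ℝ) (R : Tensor₄) : ℝ :=
  ∑ i : Fin s.n × Fin 4 → Fin 4,
    (∏ k, (if s.isRiemann k then R else fun A B C D => o * altSymbol A B C D)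
      (i (k, 0)) (i (k, 1)) (i (k, 2)) (i (k, 3)))
    * ∏ p, minkowski (i (s.pairing (p, 0))) (i (s.pairing (p, 1)))

/-- At the point `x`, the rows of `E` are an orthonormal coframe of the metric `g`, with dual frame
`F`, in which the Riemann tensor has the components `R`. -/
structure HasFrame (g : MetricField) (x : Coord) (E F : Mat) (R : Tensor₄) : Prop where
  metric_eq : g x = Eᵀ * minkowski * E
  mul_dual : E * F = 1
  riemann_eq : IsPullback E (uncurry₄ (riemann g x)) (uncurry₄ R)

lemma minkowski_mul_self : minkowski * minkowski = 1 := by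
  rw [minkowski, diagonal_mul_diagonal, ← diagonal_one]
  congr 1
  ext A
  fin_cases A <;> simp

lemma det_minkowski : minkowski.det = -1 := by
  simp [minkowski, det_diagonal, Fin.prod_univ_four]

namespace HasFrame

variable {g : MetricField} {x : Coord} {E F : Mat} {R : Tensor₄}

lemma inv_eq (h : HasFrame g x E F R) : (g x)⁻¹ = F * minkowski * Fᵀ := by
  have hdual : Fᵀ * Eᵀ = 1 := by rw [← transpose_mul, h.mul_dual, transpose_one]
  refine inv_eq_left_inv ?_
  calc F * minkowski * Fᵀ * g x
      = F * minkowski * (Fᵀ * Eᵀ) * minkowski * E := by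
        simp only [h.metric_eq, Matrix.mul_assoc]
    _ = F * (minkowski * minkowski) * E := by rw [hdual, Matrix.mul_one, Matrix.mul_assoc F]
    _ = 1 := by rw [minkowski_mul_self, Matrix.mul_one, mul_eq_one_comm.mp h.mul_dual]

lemma det_eq (h : HasFrame g x E F R) : (g x).det = -E.det ^ 2 := by
  rw [h.metric_eq, det_mul, det_mul, det_transpose, det_minkowski]
  ring

lemma isUnit_det (h : HasFrame g x E F R) : IsUnit (g x).det := by
  rw [h.det_eq]
  exact ((isUnit_det_of_right_inverse h.mul_dual).pow 2).neg

lemma isPullback_metric (h : HasFrame g x E F R) :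
    IsPullback E (uncurry₂ fun a b => g x a b) (uncurry₂ fun A B => minkowski A B) :=
  h.metric_eq ▸ isPullback_transpose_mul_mul E minkowski

lemma isPullback_inv (h : HasFrame g x E F R) :
    IsPullback Fᵀ (uncurry₂ fun a b => (g x)⁻¹ a b) (uncurry₂ fun A B => minkowski A B) :=
  h.inv_eq ▸ isPullback_transpose_mul_mul Fᵀ minkowski

lemma ricci_eq_sum (h : HasFrame g x E F R) (b d : Fin 4) :
    ricci g x b d = ∑ a, ∑ c, riemann g x a b c d * (g x)⁻¹ a c := by
  have hsymm : (g x)⁻¹ᵀ = (g x)⁻¹ := by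
    simp only [h.inv_eq, transpose_mul, transpose_transpose, Matrix.mul_assoc, minkowski,
      diagonal_transpose]
  have hup : ∀ c, riemannUp g x c b c d = ∑ a, riemann g x a b c d * (g x)⁻¹ a c := fun c => by
    calc riemannUp g x c b c d
        = ((1 : Mat) *ᵥ fun e => riemannUp g x e b c d) c := by rw [one_mulVec]
      _ = ((g x)⁻¹ *ᵥ (g x *ᵥ fun e => riemannUp g x e b c d)) c := by
          rw [mulVec_mulVec, nonsing_inv_mul _ h.isUnit_det]
      _ = ∑ a, (g x)⁻¹ᵀ a c * riemann g x a b c d := rfl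
      _ = ∑ a, riemann g x a b c d * (g x)⁻¹ a c := by simp only [hsymm, mul_comm]
  simp only [ricci, hup]
  exact Finset.sum_comm

lemma isPullback_ricci (h : HasFrame g x E F R) :
    IsPullback E (uncurry₂ (ricci g x)) (uncurry₂ (frameRicci R)) := by
  let e : Fin 4 ≃ Fin 2 ⊕ Fin 2 := Equiv.ofBijective
    ![Sum.inl 0, Sum.inr 0, Sum.inl 1, Sum.inr 1] (by decide)
  have hcontr := (h.riemann_eq.reindex e).contract h.mul_dual h.isPullback_inv
  simp only [sum_multiIndex_two] at hcontr
  have hricci : ricci g x = fun b d => ∑ a, ∑ c, riemann g x a b c d * (g x)⁻¹ a c :=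
    funext₂ h.ricci_eq_sum
  rw [hricci]
  exact hcontr

lemma scalarCurv_eq (h : HasFrame g x E F R) : scalarCurv g x = frameScalar R := by
  have hcontr := h.isPullback_ricci.sum_mul h.mul_dual h.isPullback_inv
  simp only [sum_multiIndex_two] at hcontr
  simp only [scalarCurv, mul_comm ((g x)⁻¹ _ _)]
  exact hcontr

lemma isPullback_tfRicci (h : HasFrame g x E F R) :
    IsPullback E (uncurry₂ (tfRicci g x)) (uncurry₂ (frameTfRicci R)) := by
  unfold tfRicci frameTfRicci
  rw [h.scalarCurv_eq]
  exact h.isPullback_ricci.sub (h.isPullback_metric.const_mul (frameScalar R / 4))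

lemma isPullback_tfRicciUp (h : HasFrame g x E F R) :
    IsPullback Fᵀ (uncurry₂ (tfRicciUp g x)) (uncurry₂ (frameTfRicciUp R)) := by
  have hraise := h.isPullback_tfRicci.raise h.mul_dual minkowski
  simp only [← h.inv_eq, sum_multiIndex_two, tensorPow, of_apply, Fin.prod_univ_two] at hraise
  exact hraise

lemma isPullback_weyl (h : HasFrame g x E F R) :
    IsPullback E (uncurry₄ (weyl g x)) (uncurry₄ (frameWeyl R)) := by
  let slots (i j k l : Fin 4)
      (hb : (fun p : Fin 2 × Fin 2 => ![![i, j], ![k, l]] p.1 p.2).Bijective) :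
    Fin 2 × Fin 2 ≃ Fin 4 := Equiv.ofBijective _ hb
  let acbd := slots 0 2 1 3 (by decide)
  let adbc := slots 0 3 1 2 (by decide)
  let bcad := slots 1 2 0 3 (by decide)
  let bdac := slots 1 3 0 2 (by decide)
  have hg := h.isPullback_metric
  have hr := h.isPullback_ricci
  unfold weyl frameWeyl
  rw [h.scalarCurv_eq]
  exact (h.riemann_eq.sub (((((hg.mul hr acbd).sub (hg.mul hr adbc)).sub (hg.mul hr bcad)).add
    (hg.mul hr bdac)).const_mul (1 / 2))).add
      (((hg.mul hg acbd).sub (hg.mul hg adbc)).const_mul (frameScalar R / 6))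

lemma invI6_eq (h : HasFrame g x E F R) : invI6 g x = frameInvI6 R := by
  have hcontr := h.isPullback_tfRicci.sum_mul h.mul_dual h.isPullback_tfRicciUp
  simp only [sum_multiIndex_two] at hcontr
  exact congrArg (1 / 12 * ·) hcontr

end HasFrame

lemma altSymbol_eq_detRowAlternating (j : Fin 4 → Fin 4) :
    uncurry₄ altSymbol j = detRowAlternating fun i => (1 : Mat).row (j i) := by
  have hj : ![j 0, j 1, j 2, j 3] = j := List.ofFn_inj.mp rfl
  change det _ = det _
  rw [hj]
  rfl

lemma sum_tensorPow_mul_altSymbol (E : Mat) (j : Fin 4 → Fin 4) :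
    ∑ J, tensorPow E J j * uncurry₄ altSymbol J = E.det * uncurry₄ altSymbol j := by
  have hrow : ∀ i, ∑ K, E K (j i) • (1 : Mat).row K = ((1 : Mat).submatrix j id * Eᵀ) i :=
    fun i => by
      ext K
      simp [Matrix.row, mul_apply, one_apply]
  calc ∑ J, tensorPow E J j * uncurry₄ altSymbol J
      = ∑ J : Fin 4 → Fin 4,
          detRowAlternating fun i => E (J i) (j i) • (1 : Mat).row (J i) := by
        refine Finset.sum_congr rfl fun J _ => ?_
        rw [altSymbol_eq_detRowAlternating]
        exact (detRowAlternating.toMultilinearMap.map_smul_univ (fun i => E (J i) (j i)) _).symm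
    _ = detRowAlternating fun i => ∑ K, E K (j i) • (1 : Mat).row K :=
        (detRowAlternating.toMultilinearMap.map_sum fun i K => E K (j i) • (1 : Mat).row K).symm
    _ = ((1 : Mat).submatrix j id * Eᵀ).det := by
        simp only [hrow]
        rfl
    _ = E.det * uncurry₄ altSymbol j := by
        rw [det_mul, det_transpose, mul_comm, altSymbol_eq_detRowAlternating]
        rfl

namespace HasFrame

variable {g : MetricField} {x : Coord} {E F : Mat} {R : Tensor₄}

lemma isPullback_volForm (h : HasFrame g x E F R) : IsPullback E (uncurry₄ (volForm g x))
    (uncurry₄ fun A B C D => (SignType.sign E.det : ℝ) * altSymbol A B C D) := by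
  intro j
  have hdet : √|(g x).det| = SignType.sign E.det * E.det := by
    rw [h.det_eq, abs_neg, abs_sq, Real.sqrt_sq_eq_abs, sign_mul_self]
  calc uncurry₄ (volForm g x) j
      = SignType.sign E.det * (E.det * uncurry₄ altSymbol j) := by
        rw [← mul_assoc, ← hdet]
        rfl
    _ = ∑ J, tensorPow E J j • (SignType.sign E.det * uncurry₄ altSymbol J) := by
        simp only [← sum_tensorPow_mul_altSymbol, Finset.mul_sum, smul_eq_mul, mul_left_comm]

lemma isPullback_weylDual (h : HasFrame g x E F R) : IsPullback E (uncurry₄ (weylDual g x))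
    (uncurry₄ (frameWeylDual (SignType.sign E.det) R)) := by
  let epsWeyl : Fin 2 × Fin 4 ≃ Fin 4 ⊕ Fin 4 := Equiv.ofBijective
    (fun p => ![![Sum.inr 0, Sum.inr 1, Sum.inl 0, Sum.inl 1],
      ![Sum.inl 2, Sum.inl 3, Sum.inr 2, Sum.inr 3]] p.1 p.2) (by decide)
  let raise : Fin 2 × Fin 2 ≃ Fin 4 := Equiv.ofBijective
    (fun p => ![![0, 2], ![1, 3]] p.1 p.2) (by decide)
  have hcontr := ((h.isPullback_volForm.mul h.isPullback_weyl epsWeyl).contract h.mul_dual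
    (h.isPullback_inv.mul h.isPullback_inv raise)).const_mul (1 / 2)
  simp only [sum_multiIndex_four] at hcontr
  have hdual : weylDual g x = fun a b c d => (1 / 2) * ∑ m, ∑ n, ∑ m', ∑ n',
      volForm g x a b m n * weyl g x m' n' c d * ((g x)⁻¹ m m' * (g x)⁻¹ n n') := by
    funext a b c d
    simp only [weylDual, mul_assoc, mul_comm, mul_left_comm]
  rw [hdual]
  exact hcontr

lemma isPullback_weylBar (h : HasFrame g x E F R) : IsPullback E (uncurry₄ (weylBar g x))
    (uncurry₄ (frameWeylBar (SignType.sign E.det) R)) := by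
  have hsum := ((h.isPullback_weyl.map Complex.ofRealAm.toLinearMap).add
    ((h.isPullback_weylDual.map Complex.ofRealAm.toLinearMap).const_mul Complex.I)).const_mul
      (2⁻¹ : ℂ)
  unfold weylBar frameWeylBar
  simp only [div_eq_inv_mul]
  exact hsum

lemma invI_eq (h : HasFrame g x E F R) :
    invI g x = frameInvI (SignType.sign E.det) R := by
  have hcontr := h.isPullback_weylBar.sum_mul h.mul_dual
    (h.isPullback_weylBar.raise h.mul_dual minkowski)
  simp only [← h.inv_eq, sum_multiIndex_four, tensorPow, of_apply, Fin.prod_univ_four,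
    Complex.real_smul] at hcontr
  exact congrArg (1 / 24 * ·) hcontr

lemma invK_eq (h : HasFrame g x E F R) :
    invK g x = frameInvK (SignType.sign E.det) R := by
  let acdb : Fin 4 ≃ Fin 4 := Equiv.ofBijective ![0, 2, 3, 1] (by decide)
  let cdab : Fin 2 × Fin 2 ≃ Fin 4 := Equiv.ofBijective
    (fun p => ![![2, 3], ![0, 1]] p.1 p.2) (by decide)
  have hcontr := (h.isPullback_weylBar.reindex acdb).sum_mul h.mul_dual
    ((h.isPullback_tfRicciUp.mul h.isPullback_tfRicciUp cdab).map Complex.ofRealAm.toLinearMap)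
  simp only [sum_multiIndex_four] at hcontr
  exact congrArg (1 / 4 * ·) hcontr

lemma eval_eq (h : HasFrame g x E F R) (s : ContractionScheme) :
    s.eval g x = s.frameEval (SignType.sign E.det) R := by
  have hfactor : ∀ k, IsPullback E
      (uncurry₄ (if s.isRiemann k then riemann g x else volForm g x))
      (uncurry₄ (if s.isRiemann k then R
        else fun A B C D => (SignType.sign E.det : ℝ) * altSymbol A B C D)) := fun k => by
    split_ifs
    · exact h.riemann_eq
    · exact h.isPullback_volForm
  exact (IsPullback.prod hfactor (Equiv.refl (Fin s.n × Fin 4))).sum_mul h.mul_dual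
    (IsPullback.prod (fun _ => h.isPullback_inv) s.pairing)

end HasFrame

/-! ### Approaching the ring -/

section Ring

open Asymptotics

variable {a : ℝ} {M : ℝ → ℝ}

lemma hasFrame_kerr {x : Coord} (h : x ∈ frameDomain a M) :
    HasFrame (metric a M) x (kerrCoframe a M x) (kerrFrame a M x) (kerrCurv a M x) where
  metric_eq := metric_eq_kerrCoframe h
  mul_dual := kerrCoframe_mul_kerrFrame h
  riemann_eq := isPullback_uncurry₄ (riemann_metric h)

/-- The filter of the approach to the ring. -/
def ringFilter (a : ℝ) (M : ℝ → ℝ) : Filter Coord :=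
  comap (fun x => x 1) (𝓝 0) ⊓ comap (fun x => x 2) (𝓝 (Real.pi / 2)) ⊓ 𝓟 (chartDomain a M)

lemma IsPathToRing.tendsto {γ : ℝ → Coord} (h : IsPathToRing a M γ) :
    Tendsto γ (𝓝[>] 0) (ringFilter a M) := by
  refine tendsto_inf.mpr ⟨tendsto_inf.mpr ⟨tendsto_comap_iff.mpr h.tendsto_r,
    tendsto_comap_iff.mpr h.tendsto_theta⟩, tendsto_principal.mpr ?_⟩
  filter_upwards [Ioc_mem_nhdsGT (zero_lt_one' ℝ)] with s hs using h.mem_chart s hs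

lemma tendsto_radius_ringFilter (a : ℝ) (M : ℝ → ℝ) :
    Tendsto (fun x : Coord => x 1) (ringFilter a M) (𝓝 0) :=
  (tendsto_comap.mono_left inf_le_left).mono_left inf_le_left

lemma eventually_delta_pos (ha : a ≠ 0) (hM : ContinuousAt M 0) :
    ∀ᶠ r in 𝓝 0, 0 < delta a M r := by
  have hcont : ContinuousAt (delta a M) 0 := by
    unfold delta
    fun_prop
  exact hcont.eventually_const_lt (by simp [delta, sq_pos_of_ne_zero ha])

lemma eventually_mem_frameDomain (ha : a ≠ 0) (hM : ContDiffAt ℝ 2 M 0) :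
    ∀ᶠ x in ringFilter a M, x ∈ frameDomain a M := by
  have hr := tendsto_radius_ringFilter a M
  have hchart : ∀ᶠ x in ringFilter a M, x ∈ chartDomain a M :=
    mem_inf_of_right (mem_principal_self _)
  filter_upwards [hr.eventually (hM.eventually (by simp)),
    hr.eventually (eventually_delta_pos ha hM.continuousAt), hchart] with
    x hC hΔ ⟨hpos, hlt, hne, _⟩
  have hnonneg : 0 ≤ sigma a (x 1) (x 2) := by
    unfold sigma
    positivity
  exact ⟨hC, hΔ, hpos, hlt, hnonneg.lt_of_ne' hne⟩

lemma isBigO_pow_succ_of_deriv {f : ℝ → ℝ} {n : ℕ} (hf0 : f 0 = 0)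
    (hf : ∀ᶠ r in 𝓝 0, DifferentiableAt ℝ f r) (hf' : deriv f =O[𝓝 0] fun r => r ^ n) :
    f =O[𝓝 0] fun r => r ^ (n + 1) := by
  obtain ⟨K, hK, hbound⟩ := hf'.exists_nonneg
  obtain ⟨ε, hε, hball⟩ := Metric.eventually_nhds_iff_ball.mp (hf.and hbound.bound)
  refine .of_bound K (Metric.eventually_nhds_iff_ball.mpr ⟨ε, hε, fun r hr => ?_⟩)
  have hsub : Metric.closedBall (0 : ℝ) ‖r‖ ⊆ Metric.ball 0 ε :=
    Metric.closedBall_subset_ball (mem_ball_zero_iff.mp hr)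
  have hmean := (convex_closedBall (0 : ℝ) ‖r‖).norm_image_sub_le_of_norm_deriv_le (f := f)
    (C := K * ‖r‖ ^ n) (x := 0) (y := r) (fun t ht => (hball t (hsub ht)).1)
    (fun t ht => (hball t (hsub ht)).2.trans (by
      rw [norm_pow]
      gcongr
      exact mem_closedBall_zero_iff.mp ht)) (by simp) (by simp)
  rwa [hf0, sub_zero, sub_zero, mul_assoc, ← pow_succ, ← norm_pow] at hmean

/-- The functions which vanish to third order at `0`, together with the corresponding estimates on
their first two derivatives. -/
structure VanishesToOrderThree (M : ℝ → ℝ) : Prop where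
  isBigO : M =O[𝓝 0] fun r => r ^ 3
  isBigO_deriv : deriv M =O[𝓝 0] fun r => r ^ 2
  isBigO_deriv_deriv : deriv (deriv M) =O[𝓝 0] fun r => r

lemma vanishesToOrderThree (hM : ContDiffAt ℝ 2 M 0)
    (hM₂ : (fun r => deriv (deriv M) r - deriv (deriv M) 0) =O[𝓝 0] fun r => r)
    (h₀ : M 0 = 0) (h₁ : deriv M 0 = 0) (h₂ : deriv (deriv M) 0 = 0) :
    VanishesToOrderThree M := by
  have hM₁ : ContDiffAt ℝ 1 (deriv M) 0 := hM.derivWithin (by norm_num)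
  have hdiff : ∀ᶠ r in 𝓝 0, DifferentiableAt ℝ M r :=
    (hM.eventually (by simp)).mono fun r hr => hr.differentiableAt (by simp)
  have hdiff₁ : ∀ᶠ r in 𝓝 0, DifferentiableAt ℝ (deriv M) r :=
    (hM₁.eventually (by simp)).mono fun r hr => hr.differentiableAt (by simp)
  simp only [h₂, sub_zero] at hM₂
  have hO₁ : deriv M =O[𝓝 0] fun r => r ^ 2 :=
    isBigO_pow_succ_of_deriv h₁ hdiff₁ (by simpa only [pow_one] using hM₂)
  exact ⟨isBigO_pow_succ_of_deriv h₀ hdiff hO₁, hO₁, hM₂⟩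

lemma isBigO_one_div {α : Type*} {l : Filter α} {f g : α → ℝ} (h : f =O[l] g) :
    (fun x => f x / g x) =O[l] fun _ => (1 : ℝ) :=
  (isBigO_one_iff ℝ).mpr (div_isBoundedUnder_of_isBigO h)

section Sigma

variable (a : ℝ) (l : Filter Coord)

lemma isBigO_sq_radius_sigma : (fun x => x 1 ^ 2) =O[l] fun x => sigma a (x 1) (x 2) :=
  isBigO_of_le l fun x => abs_le_abs_of_nonneg (sq_nonneg _)
    (le_add_of_nonneg_right (by positivity))

lemma isBigO_sq_cos_sigma :
    (fun x => (a * Real.cos (x 2)) ^ 2) =O[l] fun x => sigma a (x 1) (x 2) :=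
  isBigO_of_le l fun x => abs_le_abs_of_nonneg (sq_nonneg _) (by
    rw [mul_pow]
    exact le_add_of_nonneg_left (sq_nonneg _))

lemma isBigO_radius_mul_cos_sigma :
    (fun x => x 1 * (a * Real.cos (x 2))) =O[l] fun x => sigma a (x 1) (x 2) := by
  refine .trans (isBigO_of_le l fun x => ?_)
    ((isBigO_sq_radius_sigma a l).add (isBigO_sq_cos_sigma a l))
  have hsq := two_mul_le_add_sq |x 1| |a * Real.cos (x 2)|
  rw [sq_abs, sq_abs] at hsq
  have hsum : 0 ≤ x 1 ^ 2 + (a * Real.cos (x 2)) ^ 2 := by positivity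
  rw [Real.norm_eq_abs, Real.norm_eq_abs, abs_mul, abs_of_nonneg hsum]
  linarith [mul_nonneg (abs_nonneg (x 1)) (abs_nonneg (a * Real.cos (x 2)))]

end Sigma

lemma VanishesToOrderThree.isBigO_kerrCurvCoeff (hM : VanishesToOrderThree M) (a : ℝ)
    {l : Filter Coord} (hl : Tendsto (fun x => x 1) l (𝓝 0)) :
    kerrCurvCoeff a M =O[l] fun _ => (1 : ℝ) := by
  let r : Coord → ℝ := fun x => x 1
  let c : Coord → ℝ := fun x => a * Real.cos (x 2)
  let σ : Coord → ℝ := fun x => sigma a (x 1) (x 2)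
  have hr : (fun x => r x ^ 2) =O[l] σ := isBigO_sq_radius_sigma a l
  have hc : (fun x => c x ^ 2) =O[l] σ := isBigO_sq_cos_sigma a l
  have hrc : (fun x => r x * c x) =O[l] σ := isBigO_radius_mul_cos_sigma a l
  have hM₀ : (fun x => M (r x)) =O[l] fun x => r x ^ 3 := hM.isBigO.comp_tendsto hl
  have hM₁ : (fun x => deriv M (r x)) =O[l] fun x => r x ^ 2 := hM.isBigO_deriv.comp_tendsto hl
  have hM₂ : (fun x => deriv (deriv M) (r x)) =O[l] r := hM.isBigO_deriv_deriv.comp_tendsto hl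
  have hrr : r =O[l] r := isBigO_refl r l
  have hrM : (fun x => r x * M (r x)) =O[l] fun x => σ x ^ 2 :=
    ((hrr.mul hM₀).congr_right fun x => by ring).trans (hr.pow 2)
  have hm : (fun x => 2 * (r x * M (r x))) =O[l] fun x => σ x ^ 2 := hrM.const_mul_left 2
  have hm' : (fun x => M (r x) + r x * deriv M (r x)) =O[l] fun x => r x * r x ^ 2 :=
    (hM₀.congr_right fun x => by ring).add (hrr.mul hM₁)
  have hm'' : (fun x => 2 * deriv M (r x) + r x * deriv (deriv M) (r x)) =O[l] σ :=
    ((hM₁.const_mul_left 2).add ((hrr.mul hM₂).congr_right fun x => (sq (r x)).symm)).trans hr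
  have hrm' : (fun x => r x * (M (r x) + r x * deriv M (r x))) =O[l] fun x => σ x ^ 2 :=
    ((hrr.mul hm').congr_right fun x => by ring).trans (hr.pow 2)
  have hm'c : (fun x => (M (r x) + r x * deriv M (r x)) * c x) =O[l] fun x => σ x ^ 2 :=
    ((hm'.mul (isBigO_refl c l)).congr_right fun x => by ring).trans
      ((hr.mul hrc).congr_right fun x => (sq (σ x)).symm)
  have hcube : ∀ {q : Coord → ℝ}, q =O[l] σ →
      (fun x => 2 * (r x * M (r x)) * q x / σ x ^ 3) =O[l] fun _ => (1 : ℝ) := fun hq =>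
    isBigO_one_div ((hm.mul hq).congr_right fun x => (pow_succ (σ x) 2).symm)
  refine isBigO_pi.mpr fun i => ?_
  fin_cases i
  · refine (((isBigO_one_div hm'').neg_left.add ((isBigO_one_div hrm').const_mul_left 4)).sub
      (hcube ((hr.const_mul_left 3).sub hc))).congr_left fun x => ?_
    simp only [kerrCurvCoeff, Fin.zero_eta, cons_val_zero, r, c, σ]
    ring
  · exact hcube (hr.sub (hc.const_mul_left 3))
  · refine ((isBigO_one_div hrm').neg_left.add (hcube (hr.sub hc))).congr_left fun x => ?_
    simp only [kerrCurvCoeff, Fin.reduceFinMk, cons_val, r, c, σ]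
    ring
  · refine ((isBigO_one_div hm'c).sub ((hcube hrc).const_mul_left 2)).congr_left fun x => ?_
    simp only [kerrCurvCoeff, Fin.reduceFinMk, cons_val, r, c, σ]
    ring

lemma isBigO_one_comp_of_continuous {α V W : Type*} [NormedAddCommGroup V] [ProperSpace V]
    [NormedAddCommGroup W] {Φ : V → W} (hΦ : Continuous Φ) {l : Filter α} {u : α → V}
    (hu : u =O[l] fun _ => (1 : ℝ)) : (fun x => Φ (u x)) =O[l] fun _ => (1 : ℝ) := by
  obtain ⟨B, hB⟩ := hu.bound
  obtain ⟨C, hC⟩ := ((isCompact_closedBall (0 : V) B).image hΦ).isBounded.exists_norm_le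
  refine .of_bound C (hB.mono fun x hx => ?_)
  rw [norm_one, mul_one] at hx ⊢
  exact hC _ (Set.mem_image_of_mem Φ (mem_closedBall_zero_iff.mpr hx))

lemma continuous_bivForm_curvMatrix : Continuous fun f => bivForm (curvMatrix f) := by
  have hcurv : Continuous curvMatrix := by
    refine continuous_matrix fun i j => ?_
    fin_cases i <;> fin_cases j <;> simp only [curvMatrix] <;> fun_prop
  unfold bivForm
  fun_prop

lemma finiteAtRing_of_isBigO {V : Type*} [Norm V] {f : Coord → V}
    (hf : f =O[ringFilter a M] fun _ => (1 : ℝ)) : FiniteAtRing a M f := by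
  intro γ hγ
  obtain ⟨B, hB⟩ := (hf.comp_tendsto hγ.tendsto).bound
  exact ⟨B, hB.mono fun s hs => by simpa using hs⟩

lemma VanishesToOrderThree.finiteAtRing_of_continuous (hV : VanishesToOrderThree M) (ha : a ≠ 0)
    (hM : ContDiffAt ℝ 2 M 0) {V : Type*} [NormedAddCommGroup V] {Φ : ℝ × Tensor₄ → V}
    (hΦ : Continuous Φ) {f : Coord → V}
    (hf : ∀ x ∈ frameDomain a M,
      f x = Φ (SignType.sign (kerrCoframe a M x).det, kerrCurv a M x)) :
    FiniteAtRing a M f := by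
  have hsign : (fun x => (SignType.sign (kerrCoframe a M x).det : ℝ))
      =O[ringFilter a M] fun _ => (1 : ℝ) := isBigO_of_le _ fun x => by
    cases SignType.sign (kerrCoframe a M x).det <;> simp
  have hcurv := hV.isBigO_kerrCurvCoeff a (tendsto_radius_ringFilter a M)
  refine finiteAtRing_of_isBigO (.congr' (isBigO_one_comp_of_continuous (hΦ.comp
    (continuous_fst.prodMk (continuous_bivForm_curvMatrix.comp continuous_snd)))
    (hsign.prod_left hcurv)) ?_ .rfl)
  filter_upwards [eventually_mem_frameDomain ha hM] with x hx using (hf x hx).symm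

end Ring

/-! ### Finiteness of the invariants -/

section Continuity

lemma continuous_frameRicci : Continuous frameRicci := by
  unfold frameRicci
  fun_prop

lemma continuous_frameScalar : Continuous frameScalar := by
  have := continuous_frameRicci
  unfold frameScalar
  fun_prop

lemma continuous_frameTfRicci : Continuous frameTfRicci := by
  have := continuous_frameRicci
  have := continuous_frameScalar
  unfold frameTfRicci
  fun_prop

lemma continuous_frameTfRicciUp : Continuous frameTfRicciUp := by
  have := continuous_frameTfRicci
  unfold frameTfRicciUp
  fun_prop

lemma continuous_frameWeyl : Continuous frameWeyl := by
  have := continuous_frameRicci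
  have := continuous_frameScalar
  unfold frameWeyl
  fun_prop

lemma continuous_frameWeylBar : Continuous fun p : ℝ × Tensor₄ => frameWeylBar p.1 p.2 := by
  have := continuous_frameWeyl
  unfold frameWeylBar frameWeylDual
  fun_prop

lemma continuous_frameInvI6 : Continuous frameInvI6 := by
  have := continuous_frameTfRicci
  have := continuous_frameTfRicciUp
  unfold frameInvI6
  fun_prop

lemma continuous_frameInvI : Continuous fun p : ℝ × Tensor₄ => frameInvI p.1 p.2 := by
  have := continuous_frameWeylBar
  unfold frameInvI
  fun_prop

lemma continuous_frameInvK : Continuous fun p : ℝ × Tensor₄ => frameInvK p.1 p.2 := by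
  have := continuous_frameWeylBar
  have := continuous_frameTfRicciUp
  unfold frameInvK
  fun_prop

lemma continuous_frameEval (s : ContractionScheme) :
    Continuous fun p : ℝ × Tensor₄ => s.frameEval p.1 p.2 := by
  unfold ContractionScheme.frameEval
  refine continuous_finsetSum _ fun i _ => Continuous.mul ?_ continuous_const
  refine continuous_finsetProd _ fun k _ => ?_
  split_ifs <;> fun_prop

end Continuity

section Finite

variable {a : ℝ} {M : ℝ → ℝ} {V : Type*} [NormedAddCommGroup V]

lemma FiniteAtRing.add {f g : Coord → V} (hf : FiniteAtRing a M f) (hg : FiniteAtRing a M g) :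
    FiniteAtRing a M (f + g) := by
  intro γ hγ
  obtain ⟨B, hB⟩ := hf γ hγ
  obtain ⟨C, hC⟩ := hg γ hγ
  exact ⟨B + C, (hB.and hC).mono fun s hs => (norm_add_le _ _).trans (add_le_add hs.1 hs.2)⟩

lemma FiniteAtRing.const_smul [NormedSpace ℝ V] {f : Coord → V} (hf : FiniteAtRing a M f) (c : ℝ) :
    FiniteAtRing a M (c • f) := by
  intro γ hγ
  obtain ⟨B, hB⟩ := hf γ hγ
  exact ⟨‖c‖ * B, hB.mono fun s hs => (norm_smul_le c (f (γ s))).trans (by gcongr)⟩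

lemma FiniteAtRing.not_divergesAtRing {f : Coord → V} (h : FiniteAtRing a M f) :
    ¬ DivergesAtRing a M f := by
  rintro ⟨γ, hγ, ht⟩
  obtain ⟨B, hB⟩ := h γ hγ
  obtain ⟨s, hgt, hle⟩ := ((ht.eventually_gt_atTop B).and hB).exists
  exact hle.not_gt hgt

namespace VanishesToOrderThree

lemma finiteAtRing_curvatureInvariants (hV : VanishesToOrderThree M) (ha : a ≠ 0)
    (hM : ContDiffAt ℝ 2 M 0) {f : Coord → ℝ} (hf : f ∈ curvatureInvariants (metric a M)) :
    FiniteAtRing a M f := by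
  induction hf using Submodule.span_induction with
  | mem f hf =>
    obtain ⟨s, rfl⟩ := hf
    exact hV.finiteAtRing_of_continuous ha hM (continuous_frameEval s)
      fun _ hx => (hasFrame_kerr hx).eval_eq s
  | zero => exact fun _ _ => ⟨0, by simp⟩
  | add f g _ _ hf hg => exact hf.add hg
  | smul c f _ hf => exact hf.const_smul c

lemma finiteAtRing_scalarCurv (hV : VanishesToOrderThree M) (ha : a ≠ 0)
    (hM : ContDiffAt ℝ 2 M 0) : FiniteAtRing a M (scalarCurv (metric a M)) :=
  hV.finiteAtRing_of_continuous ha hM (continuous_frameScalar.comp continuous_snd)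
    fun _ hx => (hasFrame_kerr hx).scalarCurv_eq

lemma finiteAtRing_invI6 (hV : VanishesToOrderThree M) (ha : a ≠ 0) (hM : ContDiffAt ℝ 2 M 0) :
    FiniteAtRing a M (invI6 (metric a M)) :=
  hV.finiteAtRing_of_continuous ha hM (continuous_frameInvI6.comp continuous_snd)
    fun _ hx => (hasFrame_kerr hx).invI6_eq

lemma finiteAtRing_invI (hV : VanishesToOrderThree M) (ha : a ≠ 0) (hM : ContDiffAt ℝ 2 M 0) :
    FiniteAtRing a M (invI (metric a M)) :=
  hV.finiteAtRing_of_continuous ha hM continuous_frameInvI fun _ hx => (hasFrame_kerr hx).invI_eq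

lemma finiteAtRing_invK (hV : VanishesToOrderThree M) (ha : a ≠ 0) (hM : ContDiffAt ℝ 2 M 0) :
    FiniteAtRing a M (invK (metric a M)) :=
  hV.finiteAtRing_of_continuous ha hM continuous_frameInvK fun _ hx => (hasFrame_kerr hx).invK_eq

end VanishesToOrderThree

end Finite

/-! ### Positivity for sectional tensors -/

section Sectional

lemma tensorPow_minkowski_eq_zero {ι : Type*} [Fintype ι] {J K : ι → Fin 4} (h : J ≠ K) :
    tensorPow minkowski J K = 0 := by
  obtain ⟨i, hi⟩ := Function.ne_iff.mp h
  exact Finset.prod_eq_zero (Finset.mem_univ i) (diagonal_apply_ne _ hi)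

lemma sum_tensorPow_minkowski_smul {ι V : Type*} [Fintype ι] [DecidableEq ι] [AddCommGroup V]
    [Module ℝ V] (J : ι → Fin 4) (f : (ι → Fin 4) → V) :
    ∑ K, tensorPow minkowski J K • f K = tensorPow minkowski J J • f J :=
  Finset.sum_eq_single J (fun K _ hK => by rw [tensorPow_minkowski_eq_zero hK.symm, zero_smul])
    (by simp)

lemma minkowski_apply_mul_self (A : Fin 4) : minkowski A A * minkowski A A = 1 := by
  fin_cases A <;> simp [minkowski]

/-- The square `T_{ABCD} T^{ABCD}` of a tensor, by components in an orthonormal frame. -/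
def lorentzSq (T : Tensor₄) : ℝ :=
  ∑ J, tensorPow minkowski J J * uncurry₄ T J ^ 2

/-- The tensors whose only components are those of the form `T_{ABAB}` and `T_{ABBA}`, like a
curvature tensor that is determined by the sectional curvatures of the coordinate planes. -/
def IsSectional (T : Tensor₄) : Prop :=
  ∀ A B C D, s(A, B) ≠ s(C, D) → T A B C D = 0

/-- The Kretschmann scalar `R_{abcd} R^{abcd}`. -/
def kretschmannScheme : ContractionScheme where
  n := 2
  isRiemann _ := true
  pairing := Equiv.prodComm (Fin 4) (Fin 2)

lemma frameEval_kretschmannScheme (o : ℝ) (R : Tensor₄) :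
    kretschmannScheme.frameEval o R = lorentzSq R := by
  let e : (Fin 4 → Fin 4) × (Fin 4 → Fin 4) ≃ (Fin 2 × Fin 4 → Fin 4) :=
    (finTwoArrowEquiv (Fin 4 → Fin 4)).symm.trans (Equiv.curry (Fin 2) (Fin 4) (Fin 4)).symm
  calc kretschmannScheme.frameEval o R
      = ∑ i : Fin 2 × Fin 4 → Fin 4, (∏ k, uncurry₄ R fun p => i (k, p)) *
          tensorPow minkowski (fun p => i (0, p)) fun p => i (1, p) := rfl
    _ = ∑ J, ∑ K, uncurry₄ R J * uncurry₄ R K * tensorPow minkowski J K := by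
        rw [← e.sum_comp, Fintype.sum_prod_type]
        simp only [Fin.prod_univ_two]
        rfl
    _ = ∑ J, ∑ K, tensorPow minkowski J K • (uncurry₄ R J * uncurry₄ R K) :=
        Finset.sum_congr rfl fun J _ => Finset.sum_congr rfl fun K _ => mul_comm _ _
    _ = ∑ J, tensorPow minkowski J J • (uncurry₄ R J * uncurry₄ R J) := by
        simp only [sum_tensorPow_minkowski_smul]
    _ = lorentzSq R := by
        simp only [lorentzSq, smul_eq_mul, sq]

lemma frameInvI6_eq_sum (R : Tensor₄) :
    12 * frameInvI6 R =
      ∑ A, ∑ B, minkowski A A * minkowski B B * frameTfRicci R A B ^ 2 := by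
  have hup : ∀ A B, frameTfRicciUp R A B =
      minkowski A A * minkowski B B * frameTfRicci R A B := fun A B => by
    have := sum_tensorPow_minkowski_smul ![A, B] (uncurry₂ (frameTfRicci R))
    simp only [sum_multiIndex_two, tensorPow, of_apply, Fin.prod_univ_two, smul_eq_mul] at this
    exact this
  simp only [frameInvI6, hup]
  rw [← mul_assoc, mul_one_div_cancel (by norm_num), one_mul]
  exact Finset.sum_congr rfl fun A _ => Finset.sum_congr rfl fun B _ => by ring

lemma frameInvI_eq_sum (o : ℝ) (R : Tensor₄) :
    frameInvI o R =
      (1 / 24) * ∑ J, tensorPow minkowski J J • uncurry₄ (frameWeylBar o R) J ^ 2 := by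
  have hup : ∀ A B C D, ∑ A', ∑ B', ∑ C', ∑ D',
      ((minkowski A A' * minkowski B B' * minkowski C C' * minkowski D D' : ℝ) : ℂ)
        * frameWeylBar o R A' B' C' D' =
      tensorPow minkowski ![A, B, C, D] ![A, B, C, D] • frameWeylBar o R A B C D :=
    fun A B C D => by
      have := sum_tensorPow_minkowski_smul ![A, B, C, D] (uncurry₄ (frameWeylBar o R))
      simp only [sum_multiIndex_four, tensorPow, of_apply, Fin.prod_univ_four] at this
      simp only [← Complex.real_smul, tensorPow, of_apply, Fin.prod_univ_four]
      exact this
  simp only [frameInvI, hup, sum_multiIndex_four, mul_smul_comm, ← sq]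
  rfl

lemma re_frameInvI (o : ℝ) (R : Tensor₄) :
    96 * (frameInvI o R).re = lorentzSq (frameWeyl R) - lorentzSq (frameWeylDual o R) := by
  have hre : ∀ J, (uncurry₄ (frameWeylBar o R) J ^ 2).re =
      (uncurry₄ (frameWeyl R) J ^ 2 - uncurry₄ (frameWeylDual o R) J ^ 2) / 4 := fun J => by
    simp [uncurry₄, frameWeylBar, sq]
    ring
  have hcoeff : (1 / 24 : ℂ) = ((1 / 24 : ℝ) : ℂ) := by norm_num
  rw [frameInvI_eq_sum, hcoeff, Complex.re_ofReal_mul, Complex.re_sum]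
  simp only [Complex.smul_re, hre, smul_eq_mul, lorentzSq, ← Finset.sum_sub_distrib,
    Finset.mul_sum]
  exact Finset.sum_congr rfl fun J _ => by ring

lemma altSymbol_eq_zero {J : Fin 4 → Fin 4} (hJ : ¬ Function.Injective J) :
    uncurry₄ altSymbol J = 0 := by
  rw [altSymbol_eq_detRowAlternating]
  exact detRowAlternating.map_eq_zero_of_not_injective _ fun hinj =>
    hJ (Function.Injective.of_comp (f := (1 : Mat).row) hinj)

namespace IsSectional

variable {R T : Tensor₄}

lemma lorentzSq_eq_sum_sq (h : IsSectional T) : lorentzSq T = ∑ J, uncurry₄ T J ^ 2 := by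
  refine Finset.sum_congr rfl fun J _ => ?_
  by_cases hJ : s(J 0, J 1) = s(J 2, J 3)
  · have hsign : tensorPow minkowski J J = 1 := by
      simp only [tensorPow, of_apply, Fin.prod_univ_four]
      rcases Sym2.eq_iff.mp hJ with ⟨h₀, h₁⟩ | ⟨h₀, h₁⟩ <;> rw [h₀, h₁] <;>
        linear_combination minkowski (J 3) (J 3) * minkowski (J 3) (J 3) *
          minkowski_apply_mul_self (J 2) + minkowski_apply_mul_self (J 3)
    rw [hsign, one_mul]
  · rw [uncurry₄, h _ _ _ _ hJ, zero_pow two_ne_zero, mul_zero]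

lemma sq_le_lorentzSq (h : IsSectional T) (A B C D : Fin 4) : T A B C D ^ 2 ≤ lorentzSq T := by
  rw [h.lorentzSq_eq_sum_sq]
  exact Finset.single_le_sum (f := fun J => uncurry₄ T J ^ 2) (fun J _ => sq_nonneg _)
    (Finset.mem_univ ![A, B, C, D])

lemma frameRicci_eq_zero (h : IsSectional R) : Pairwise fun B D => frameRicci R B D = 0 := by
  refine fun B D hBD => Finset.sum_eq_zero fun A _ => Finset.sum_eq_zero fun C _ => ?_
  by_cases hAC : A = C
  · rw [h _ _ _ _ (by rwa [hAC, ne_eq, Sym2.congr_right]), zero_mul]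
  · rw [minkowski, diagonal_apply_ne _ hAC, mul_zero]

lemma frameTfRicci_eq_zero (h : IsSectional R) {B D : Fin 4} (hBD : B ≠ D) :
    frameTfRicci R B D = 0 := by
  rw [frameTfRicci, h.frameRicci_eq_zero hBD, minkowski, diagonal_apply_ne _ hBD, mul_zero,
    sub_zero]

lemma frameWeyl (h : IsSectional R) : IsSectional (frameWeyl R) := by
  intro A B C D hne
  have hη : Pairwise fun A B => minkowski A B = 0 := fun A B hAB => diagonal_apply_ne _ hAB
  have hmul : ∀ {X Y : Fin 4 → Fin 4 → ℝ}, (Pairwise fun A B => X A B = 0) →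
      (Pairwise fun A B => Y A B = 0) → X A C * Y B D = 0 ∧ X A D * Y B C = 0 := by
    intro X Y hX hY
    constructor
    · by_cases hAC : A = C
      · rw [hY fun hBD => hne (by rw [hAC, hBD]), mul_zero]
      · rw [hX hAC, zero_mul]
    · by_cases hAD : A = D
      · rw [hY fun hBC => hne (by rw [hAD, hBC, Sym2.eq_swap]), mul_zero]
      · rw [hX hAD, zero_mul]
  obtain ⟨h₁, h₂⟩ := hmul hη h.frameRicci_eq_zero
  obtain ⟨h₃, h₄⟩ := hmul h.frameRicci_eq_zero hη
  obtain ⟨h₅, h₆⟩ := hmul hη hη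
  rw [KerrLike.frameWeyl, h _ _ _ _ hne]
  linear_combination -(1 / 2) * (h₁ - h₂ - h₄ + h₃) + frameScalar R / 6 * (h₅ - h₆)

lemma frameWeylDual_eq_zero (h : IsSectional R) (o : ℝ) {J : Fin 4 → Fin 4}
    (hJ : ¬ Function.Injective J) : uncurry₄ (frameWeylDual o R) J = 0 := by
  have halt : ∀ M N, s(M, N) = s(J 2, J 3) → altSymbol (J 0) (J 1) M N = 0 := by
    rintro M N hMN
    rcases Sym2.eq_iff.mp hMN with ⟨rfl, rfl⟩ | ⟨rfl, rfl⟩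
    · exact altSymbol_eq_zero hJ
    · exact altSymbol_eq_zero (J := J ∘ Equiv.swap 2 3) fun hinj =>
        hJ ((Equiv.injective_comp _ J).mp hinj)
  refine mul_eq_zero_of_right _ <| Finset.sum_eq_zero fun M _ => Finset.sum_eq_zero fun N _ =>
    Finset.sum_eq_zero fun M' _ => Finset.sum_eq_zero fun N' _ => ?_
  by_cases hMN : s(M, N) = s(J 2, J 3)
  · rw [halt M N hMN, mul_zero, zero_mul, zero_mul]
  · by_cases hM : M = M'
    · by_cases hN : N = N'
      · rw [h.frameWeyl _ _ _ _ (hM ▸ hN ▸ hMN), mul_zero, zero_mul]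
      · rw [minkowski, diagonal_apply_ne _ hN, mul_zero, mul_zero]
    · rw [minkowski, diagonal_apply_ne _ hM, zero_mul, mul_zero]

-- A component of the dual needs all four frame directions, exactly one of them timelike.
lemma lorentzSq_frameWeylDual_nonpos (h : IsSectional R) (o : ℝ) :
    lorentzSq (frameWeylDual o R) ≤ 0 := by
  refine Finset.sum_nonpos fun J _ => ?_
  by_cases hJ : Function.Injective J
  · have hsign : tensorPow minkowski J J = -1 := by
      rw [tensorPow, of_apply,
        (Finite.injective_iff_bijective.mp hJ).prod_comp fun A => minkowski A A]
      simp [minkowski, Fin.prod_univ_four]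
    rw [hsign, neg_one_mul, neg_nonpos]
    exact sq_nonneg _
  · rw [h.frameWeylDual_eq_zero o hJ, zero_pow two_ne_zero, mul_zero]

lemma sq_frameTfRicci_le (h : IsSectional R) (A : Fin 4) :
    KerrLike.frameTfRicci R A A ^ 2 ≤ 12 * frameInvI6 R := by
  have hdiag : ∀ A, ∑ B, minkowski A A * minkowski B B * frameTfRicci R A B ^ 2 =
      frameTfRicci R A A ^ 2 := fun A => by
    rw [Finset.sum_eq_single A (fun B _ hB => by
      rw [h.frameTfRicci_eq_zero hB.symm, zero_pow two_ne_zero, mul_zero]) (by simp),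
      minkowski_apply_mul_self, one_mul]
  rw [frameInvI6_eq_sum]
  simp only [hdiag]
  exact Finset.single_le_sum (f := fun A => frameTfRicci R A A ^ 2) (fun A _ => sq_nonneg _)
    (Finset.mem_univ A)

lemma sq_frameWeyl_le (h : IsSectional R) (o : ℝ) (A B C D : Fin 4) :
    KerrLike.frameWeyl R A B C D ^ 2 ≤ 96 * ‖frameInvI o R‖ := by
  have hdual := h.lorentzSq_frameWeylDual_nonpos o
  have hre := re_frameInvI o R
  have hnorm := Complex.re_le_norm (frameInvI o R)
  linarith [h.frameWeyl.sq_le_lorentzSq A B C D]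

end IsSectional

lemma isSectional_bivForm {Q : Matrix (Fin 6) (Fin 6) ℝ} (hQ : Q.IsDiag) :
    IsSectional (bivForm Q) := by
  let index : Matrix (Fin 4) (Fin 4) (Fin 6) :=
    !![0, 0, 1, 2; 0, 0, 3, 4; 1, 3, 0, 5; 2, 4, 5, 0]
  have hindex : ∀ A B C D, A ≠ B → C ≠ D → index A B = index C D →
      (A = C ∧ B = D) ∨ (A = D ∧ B = C) := by
    intro A B C D
    fin_cases A <;> fin_cases B <;> fin_cases C <;> fin_cases D <;> simp [index]
  have hself : ∀ A, (!![0, 1, 1, 1; -1, 0, 1, 1; -1, -1, 0, 1; -1, -1, -1, 0] : Mat) A A = 0 := by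
    intro A
    fin_cases A <;> rfl
  intro A B C D hne
  by_cases hAB : A = B
  · rw [hAB, bivForm, hself, zero_mul, zero_mul]
  by_cases hCD : C = D
  · rw [hCD, bivForm, hself, mul_zero, zero_mul]
  rw [bivForm, hQ fun h => hne (Sym2.eq_iff.mpr (hindex A B C D hAB hCD h)), mul_zero]

lemma isDiag_curvMatrix {f : Fin 4 → ℝ} (hf : f 3 = 0) : (curvMatrix f).IsDiag := by
  intro i j hij
  fin_cases i <;> fin_cases j <;> simp [curvMatrix, hf] at hij ⊢

lemma frameTfRicci_add_sub_frameWeyl (f : Fin 4 → ℝ) :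
    frameTfRicci (bivForm (curvMatrix f)) 0 0 + frameScalar (bivForm (curvMatrix f)) / 12 -
      frameWeyl (bivForm (curvMatrix f)) 0 1 0 1 = f 1 := by
  simp only [frameWeyl, frameTfRicci, frameScalar, frameRicci, minkowski, bivForm, curvMatrix]
  simp [Fin.sum_univ_four]
  ring

lemma abs_curvCoeff_one_le {f : Fin 4 → ℝ} (hf : f 3 = 0) (o : ℝ) :
    |f 1| ≤ √(12 * frameInvI6 (bivForm (curvMatrix f))) +
      |frameScalar (bivForm (curvMatrix f))| / 12 +
        √(96 * ‖frameInvI o (bivForm (curvMatrix f))‖) := by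
  have hsec := isSectional_bivForm (isDiag_curvMatrix hf)
  have hRic := Real.abs_le_sqrt (hsec.sq_frameTfRicci_le 0)
  have hWeyl := Real.abs_le_sqrt (hsec.sq_frameWeyl_le o 0 1 0 1)
  rw [abs_le] at hRic hWeyl
  have hscalar := abs_le.mp (le_refl |frameScalar (bivForm (curvMatrix f))|)
  rw [← frameTfRicci_add_sub_frameWeyl f, abs_le]
  constructor <;> linarith

lemma sq_curvCoeff_one_le {f : Fin 4 → ℝ} (hf : f 3 = 0) :
    f 1 ^ 2 ≤ lorentzSq (bivForm (curvMatrix f)) := by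
  have h := (isSectional_bivForm (isDiag_curvMatrix hf)).sq_le_lorentzSq 2 3 2 3
  simpa [bivForm, curvMatrix] using h

end Sectional

/-! ### Divergence in the equatorial plane -/

section Divergence

open Bornology

lemma tendsto_div_pow_cobounded {f : ℝ → ℝ} {n : ℕ} (hf : ContinuousAt f 0) (hf0 : f 0 ≠ 0)
    (hn : n ≠ 0) : Tendsto (fun r => f r / r ^ n) (𝓝[>] 0) (cobounded ℝ) := by
  have hpow : Tendsto (fun r : ℝ => (r⁻¹) ^ n) (𝓝[>] 0) atTop :=
    (tendsto_pow_atTop hn).comp tendsto_inv_nhdsGT_zero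
  rw [← tendsto_norm_atTop_iff_cobounded]
  refine ((hf.norm.tendsto.mono_left nhdsWithin_le_nhds).pos_mul_atTop (norm_pos_iff.mpr hf0)
    hpow).congr' ?_
  filter_upwards [self_mem_nhdsWithin] with r hr
  rw [norm_div, norm_pow, Real.norm_of_nonneg (Set.mem_Ioi.mp hr).le, inv_pow, div_eq_mul_inv]

lemma tendsto_div_pow_succ_cobounded_of_deriv {f : ℝ → ℝ} {n : ℕ} (hf0 : f 0 = 0)
    (hf : ∀ᶠ r in 𝓝 0, DifferentiableAt ℝ f r)
    (hf' : Tendsto (fun r => deriv f r / r ^ n) (𝓝[>] 0) (cobounded ℝ)) :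
    Tendsto (fun r => f r / r ^ (n + 1)) (𝓝[>] 0) (cobounded ℝ) := by
  refine HasDerivAt.lhopital_zero_nhdsGT (f' := deriv f) (g' := fun r => (n + 1 : ℝ) * r ^ n)
    ?_ ?_ ?_ ?_ ?_ ?_
  · exact nhdsWithin_le_nhds (hf.mono fun r hr => hr.hasDerivAt)
  · exact Eventually.of_forall fun r => by simpa using hasDerivAt_pow (n + 1) r
  · filter_upwards [self_mem_nhdsWithin] with r hr
    have : 0 < r := hr
    positivity
  · exact (hf0 ▸ hf.self_of_nhds.continuousAt.tendsto).mono_left nhdsWithin_le_nhds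
  · exact ((continuous_pow (n + 1)).tendsto' 0 0 (by simp)).mono_left nhdsWithin_le_nhds
  · have hn : ((n : ℝ) + 1) ≠ 0 := n.cast_add_one_ne_zero
    refine ((tendsto_mul_left_cobounded (inv_ne_zero hn)).comp hf').congr fun r => ?_
    simp only [Function.comp_apply]
    field_simp

lemma tendsto_div_cube_cobounded {M : ℝ → ℝ} (hM : ContDiffAt ℝ 2 M 0)
    (h : ¬ (M 0 = 0 ∧ deriv M 0 = 0 ∧ deriv (deriv M) 0 = 0)) :
    Tendsto (fun r => M r / r ^ 3) (𝓝[>] 0) (cobounded ℝ) := by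
  have hM' : ContDiffAt ℝ 1 (deriv M) 0 := hM.derivWithin (by norm_num)
  by_cases h₀ : M 0 = 0
  · refine tendsto_div_pow_succ_cobounded_of_deriv h₀
      ((hM.eventually (by simp)).mono fun r hr => hr.differentiableAt (by simp)) ?_
    by_cases h₁ : deriv M 0 = 0
    · refine tendsto_div_pow_succ_cobounded_of_deriv h₁
        ((hM'.eventually (by simp)).mono fun r hr => hr.differentiableAt (by simp)) ?_
      exact tendsto_div_pow_cobounded (hM'.derivWithin (m := 0) (by norm_num)).continuousAt
        (fun h₂ => h ⟨h₀, h₁, h₂⟩) one_ne_zero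
    · exact tendsto_div_pow_cobounded hM'.continuousAt h₁ two_ne_zero
  · exact tendsto_div_pow_cobounded hM.continuousAt h₀ three_ne_zero

variable {a : ℝ} {M : ℝ → ℝ}

lemma kerrCurvCoeff_one_of_equator {x : Coord} (hx : x 2 = Real.pi / 2) :
    kerrCurvCoeff a M x 1 = 2 * (M (x 1) / x 1 ^ 3) := by
  simp [kerrCurvCoeff, sigma, hx]
  field_simp

lemma kerrCurvCoeff_three_of_equator {x : Coord} (hx : x 2 = Real.pi / 2) :
    kerrCurvCoeff a M x 3 = 0 := by
  simp [kerrCurvCoeff, hx]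

/-- The radial path `r = ε s` in the equatorial plane. -/
def equatorialPath (ε s : ℝ) : Coord := ![0, ε * s, Real.pi / 2, 0]

lemma exists_equatorialPath (ha : a ≠ 0) (hM : ContDiffAt ℝ 2 M 0) :
    ∃ ε > 0, IsPathToRing a M (equatorialPath ε) ∧
      ∀ s ∈ Set.Ioc (0 : ℝ) 1, equatorialPath ε s ∈ frameDomain a M := by
  obtain ⟨δ, hδ, h⟩ := Metric.eventually_nhds_iff.mp
    ((hM.eventually (by simp)).and (eventually_delta_pos ha hM.continuousAt))
  have hmem : ∀ s ∈ Set.Ioc (0 : ℝ) 1, equatorialPath (δ / 2) s ∈ frameDomain a M := by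
    rintro s ⟨hs₀, hs₁⟩
    have hdist : dist (δ / 2 * s) 0 < δ := by
      rw [dist_zero_right, Real.norm_of_nonneg (by positivity)]
      nlinarith
    refine ⟨(h hdist).1, (h hdist).2, Real.pi_div_two_pos, half_lt_self Real.pi_pos, ?_⟩
    change 0 < (δ / 2 * s) ^ 2 + a ^ 2 * _ ^ 2
    positivity
  refine ⟨δ / 2, half_pos hδ, ⟨?_, fun s hs => ?_, ?_, tendsto_const_nhds⟩, hmem⟩
  · unfold equatorialPath
    fun_prop
  · obtain ⟨-, hΔ, hpos, hlt, hσ⟩ := hmem s hs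
    exact ⟨hpos, hlt, hσ.ne', hΔ.ne'⟩
  · exact ((continuous_const_mul (δ / 2)).tendsto' 0 0 (mul_zero _)).mono_left nhdsWithin_le_nhds

lemma tendsto_abs_kerrCurvCoeff_equatorialPath {ε : ℝ} (hε : 0 < ε) (hM : ContDiffAt ℝ 2 M 0)
    (h : ¬ (M 0 = 0 ∧ deriv M 0 = 0 ∧ deriv (deriv M) 0 = 0)) :
    Tendsto (fun s => |kerrCurvCoeff a M (equatorialPath ε s) 1|) (𝓝[>] 0) atTop := by
  have hradius : Tendsto (fun s => ε * s) (𝓝[>] 0) (𝓝[>] 0) :=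
    tendsto_nhdsWithin_iff.mpr
      ⟨((continuous_const_mul ε).tendsto' 0 0 (mul_zero ε)).mono_left nhdsWithin_le_nhds,
        eventually_mem_nhdsWithin.mono fun s hs => mul_pos hε hs⟩
  have hcoeff := (tendsto_mul_left_cobounded two_ne_zero).comp
    ((tendsto_div_cube_cobounded hM h).comp hradius)
  refine (tendsto_norm_atTop_iff_cobounded.mpr hcoeff).congr fun s => ?_
  rw [kerrCurvCoeff_one_of_equator rfl]
  rfl

theorem jet_eq_zero_of_not_divergesAtRing (ha : a ≠ 0) (hM : ContDiffAt ℝ 2 M 0)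
    (h : ∀ f ∈ curvatureInvariants (metric a M), ¬ DivergesAtRing a M f) :
    M 0 = 0 ∧ deriv M 0 = 0 ∧ deriv (deriv M) 0 = 0 := by
  by_contra hjet
  obtain ⟨ε, hε, hpath, hmem⟩ := exists_equatorialPath ha hM
  have hcoeff := tendsto_abs_kerrCurvCoeff_equatorialPath (a := a) hε hM hjet
  refine h (kretschmannScheme.eval (metric a M)) (Submodule.subset_span ⟨_, rfl⟩)
    ⟨equatorialPath ε, hpath, tendsto_atTop_mono' _ ?_
      ((tendsto_pow_atTop two_ne_zero).comp hcoeff)⟩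
  filter_upwards [Ioc_mem_nhdsGT (zero_lt_one' ℝ)] with s hs
  rw [(hasFrame_kerr (hmem s hs)).eval_eq, frameEval_kretschmannScheme, Function.comp_apply, sq_abs]
  exact (sq_curvCoeff_one_le (kerrCurvCoeff_three_of_equator rfl)).trans (le_abs_self _)

theorem jet_eq_zero_of_finiteAtRing (ha : a ≠ 0) (hM : ContDiffAt ℝ 2 M 0)
    (hR : FiniteAtRing a M (scalarCurv (metric a M))) (hI6 : FiniteAtRing a M (invI6 (metric a M)))
    (hI : FiniteAtRing a M (invI (metric a M))) :
    M 0 = 0 ∧ deriv M 0 = 0 ∧ deriv (deriv M) 0 = 0 := by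
  by_contra hjet
  obtain ⟨ε, hε, hpath, hmem⟩ := exists_equatorialPath ha hM
  obtain ⟨B₁, hB₁⟩ := hR _ hpath
  obtain ⟨B₂, hB₂⟩ := hI6 _ hpath
  obtain ⟨B₃, hB₃⟩ := hI _ hpath
  have hbound : ∀ᶠ s in 𝓝[>] 0, |kerrCurvCoeff a M (equatorialPath ε s) 1| ≤
      √(12 * B₂) + B₁ / 12 + √(96 * B₃) := by
    filter_upwards [Ioc_mem_nhdsGT (zero_lt_one' ℝ), hB₁, hB₂, hB₃] with s hs h₁ h₂ h₃
    have hframe := hasFrame_kerr (hmem s hs)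
    rw [hframe.scalarCurv_eq] at h₁
    rw [hframe.invI6_eq] at h₂
    rw [hframe.invI_eq] at h₃
    refine (abs_curvCoeff_one_le (kerrCurvCoeff_three_of_equator rfl)
      (SignType.sign (kerrCoframe a M (equatorialPath ε s)).det)).trans ?_
    gcongr
    exacts [(le_abs_self _).trans h₂, h₁, h₃]
  have hdiv := tendsto_abs_kerrCurvCoeff_equatorialPath (a := a) hε hM hjet
  obtain ⟨s, hgt, hle⟩ := ((hdiv.eventually_gt_atTop _).and hbound).exists
  exact hle.not_gt hgt

end Divergence

lemma differentiableAt_iteratedDeriv {f : ℝ → ℝ} {x : ℝ} {n : WithTop ℕ∞} {m : ℕ}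
    (hf : ContDiffAt ℝ n f x) (hmn : m < n) : DifferentiableAt ℝ (iteratedDeriv m f) x := by
  rw [← differentiableWithinAt_univ, ← iteratedDerivWithin_univ]
  exact hf.contDiffWithinAt.differentiableWithinAt_iteratedDerivWithin hmn (by simp)

end KerrLike

end

theorem theorem1_general (a : ℝ) (ha : a ≠ 0) (M : ℝ → ℝ) (hM : ContDiffAt ℝ 2 M 0)
    (hM₂ : (fun r => iteratedDeriv 2 M r - iteratedDeriv 2 M 0) =O[𝓝 0] fun r => r) :
    List.TFAE [
      ∀ f ∈ KerrLike.curvatureInvariants (KerrLike.metric a M), KerrLike.FiniteAtRing a M f,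
      ∀ f ∈ KerrLike.curvatureInvariants (KerrLike.metric a M), ¬ KerrLike.DivergesAtRing a M f,
      KerrLike.FiniteAtRing a M (KerrLike.scalarCurv (KerrLike.metric a M)) ∧
        KerrLike.FiniteAtRing a M (KerrLike.invI6 (KerrLike.metric a M)) ∧
        KerrLike.FiniteAtRing a M (KerrLike.invI (KerrLike.metric a M)) ∧
        KerrLike.FiniteAtRing a M (KerrLike.invK (KerrLike.metric a M)),
      M 0 = 0 ∧ deriv M 0 = 0 ∧ iteratedDeriv 2 M 0 = 0] := by
  have hderiv : iteratedDeriv 2 M = deriv (deriv M) := by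
    rw [iteratedDeriv_succ, iteratedDeriv_one]
  rw [hderiv] at hM₂ ⊢
  tfae_have 1 → 2 := fun h f hf => (h f hf).not_divergesAtRing
  tfae_have 2 → 4 := KerrLike.jet_eq_zero_of_not_divergesAtRing ha hM
  tfae_have 4 → 1 := fun ⟨h₀, h₁, h₂⟩ _ hf =>
    (KerrLike.vanishesToOrderThree hM hM₂ h₀ h₁ h₂).finiteAtRing_curvatureInvariants ha hM hf
  tfae_have 4 → 3 := fun ⟨h₀, h₁, h₂⟩ =>
    have hV := KerrLike.vanishesToOrderThree hM hM₂ h₀ h₁ h₂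
    ⟨hV.finiteAtRing_scalarCurv ha hM, hV.finiteAtRing_invI6 ha hM, hV.finiteAtRing_invI ha hM,
      hV.finiteAtRing_invK ha hM⟩
  tfae_have 3 → 4 := fun ⟨hR, hI6, hI, _⟩ => KerrLike.jet_eq_zero_of_finiteAtRing ha hM hR hI6 hI
  tfae_finish

theorem theorem1 (a : ℝ) (ha : a ≠ 0) (M : ℝ → ℝ) (hM : ContDiffAt ℝ 3 M 0) :
    List.TFAE [
      ∀ f ∈ KerrLike.curvatureInvariants (KerrLike.metric a M), KerrLike.FiniteAtRing a M f,
      ∀ f ∈ KerrLike.curvatureInvariants (KerrLike.metric a M), ¬ KerrLike.DivergesAtRing a M f,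
      KerrLike.FiniteAtRing a M (KerrLike.scalarCurv (KerrLike.metric a M)) ∧
        KerrLike.FiniteAtRing a M (KerrLike.invI6 (KerrLike.metric a M)) ∧
        KerrLike.FiniteAtRing a M (KerrLike.invI (KerrLike.metric a M)) ∧
        KerrLike.FiniteAtRing a M (KerrLike.invK (KerrLike.metric a M)),
      M 0 = 0 ∧ deriv M 0 = 0 ∧ iteratedDeriv 2 M 0 = 0] :=
  theorem1_general a ha M (hM.of_le (by norm_num))
    (by simpa using (KerrLike.differentiableAt_iteratedDeriv hM (m := 2) (by norm_num)).isBigO_sub)
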